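/- **Setting.** Let $\Gamma\subset\mathrm{SL}(2,\mathbb R)$ be a discrete subgroup with $-1\in\Gamma$ and finite covolume, such that the hyperbolic surface $\mathcal Y=\Gamma\backslash\mathbb H$ has $K\ge 1$ cusps. Put $\mathcal X=\Gamma\backslash\mathrm{SL}(2,\mathbb R)$ (the unit tangent bundle of $\mathcal Y$), let $\pi:\mathcal X\to\mathcal Y$, $\pi(\Gamma g)=\Gamma g i$, be the projection, and let $\mu$ be the Liouville measure on $\mathcal X$, i.e. the measure induced by Haar measure, normalised so that $\mu(\mathcal X)=1$. For $x\in\mathcal X$ define $$\varphi_t(x)=x\begin{pmatrix}e^{t/2}&0\\0&e^{-t/2}\end{pmatrix},\qquad h^+_s(x)=x\begin{pmatrix}1&0\\-s&1\end{pmatrix},\qquad h^-_s(x)=x\begin{pmatrix}1&s\\0&1\end{pmatrix}$$ (geodesic, unstable and stable horocycle flow). A Borel probability measure $\lambda$ on $\mathcal X$ is *admissible* if $\lim_{t\to\infty}\lambda(\varphi_t\mathcal E)=\mu(\mathcal E)$ for every Borel set $\mathcal E\subset\mathcal X$ with $\mu(\partial\mathcal E)=0$. **Sections.** For $\kappa=1,\dots,K$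 let $g_\kappa\in\mathrm{SL}(2,\mathbb R)$ map the $\kappa$th cusp to a cusp at infinity of width one, so that $g_\kappa^{-1}\begin{pmatrix}1&s\\0&1\end{pmatrix}g_\kappa\in\Gamma$ if and only if $s\in\mathbb Z$. Put $x_\kappa=\Gamma g_\kappa^{-1}$; then $\mathcal C_\kappa=\{h^-_s(x_\kappa):s\in\mathbb R\}$ is the closed stable horocycle of length one around the cusp. For $\sigma\in\mathbb R^K$ let $$\Sigma^K(\sigma)=\{(s,t,\kappa): s\in[0,1),\ t\ge\sigma_\kappa,\ 1\le \kappa\le K\},\qquad \iota(s,t,\kappa)=\varphi_t\circ h_s^-(x_\kappa),$$ and let $\mathcal H(\sigma)=\iota(\Sigma^K(\sigma))=\bigcup_\kappa\bigcup_{t\ge\sigma_\kappa}\varphi_t(\mathcal C_\kappa)$. The map $\iota$ is injective on $\Sigma^K(\sigma)$. **Heights.** The relative height of $x=\iota(s,t,\kappa)\in\mathcal H(\sigma)$ is $\widetilde\tau(x,\sigma)=t-\sigma_\kappa$. The relative height $\widetilde\tau(y,\sigma)$ of $y\in\pi\mathcal H(\sigma)$ is the relative height of the point of $\pi^{-1}(y)\cap\mathcal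 H(\sigma)$; this point is unique if all $\sigma_\kappa$ are sufficiently large, and in general the largest relative height is taken. Points outside $\mathcal H(\sigma)$, respectively $\pi\mathcal H(\sigma)$, have height $-\infty$, and a supremum over the empty set is $-\infty$. **Hitting times and density.** Let $\xi_1<\xi_2<\dots$, $\xi_j=\xi_j(x_0,\sigma)$, be the times $r>0$ at which $h_r^+(x_0)\in\mathcal H(\sigma)$. For $(s,t,\kappa)\in\Sigma^K(\sigma)$ let $\eta_{1}(s,t,\kappa)$, respectively $\eta_{-1}(s,t,\kappa)$, be the infimum of the $r>0$ with $h^+_{r}(\iota(s,t,\kappa))\in\mathcal H(\sigma)$, respectively $h^+_{-r}(\iota(s,t,\kappa))\in\mathcal H(\sigma)$ ($\infty$ if there is none). Put $$\overline\eta_1(\sigma)=\sum_{\kappa=1}^K\int_0^1\int_{\sigma_\kappa}^\infty\eta_1(s,t,\kappa)\,e^{-t}\,dt\,ds,\qquad \Psi_\sigma(r)=\frac1{\overline\eta_1(\sigma)}\sum_{\kappa=1}^K\int_0^1\int_{\sigma_\kappa}^\infty\mathbf 1\big(r<\eta_{-1}(s,t,\kappa)\big)\,e^{-t}\,dt\,ds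 .$$ **Theorem.** Let $\lambda$ be admissible and $\sigma\in\mathbb R^K$. Then $\rho_\sigma(s)=e^{-s}\,\Psi_\sigma(e^{-s})$ is an $\mathrm L^1$ probability density on $\mathbb R$, and for every $H\in\mathbb R$ $$\lim_{T\to\infty}\lambda\Big\{x_0\in\mathcal X:\ \sup_{0\le s\le T}\widetilde\tau(\pi\circ h^+_s(x_0),\sigma)>H+\log T\Big\}=\int_H^\infty\rho_\sigma(s)\,ds$$ and $$\lim_{T\to\infty}\lambda\Big\{x_0\in\mathcal X:\ \sup_{0\le\xi_j\le T}\widetilde\tau(h^+_{\xi_j}(x_0),\sigma)>H+\log T\Big\}=\int_H^\infty\rho_\sigma(s)\,ds .$$ -/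

import Mathlib

open MeasureTheory Filter Topology
open scoped ENNReal MatrixGroups

noncomputable section

namespace HorocycleExtremes

/-! ### The group `SL(2, ℝ)` and its Haar measure -/

instance instMeasurableSpaceSL : MeasurableSpace SL(2, ℝ) := borel _

instance instBorelSpaceSL : BorelSpace SL(2, ℝ) := ⟨rfl⟩

instance instLocallyCompactSpaceSL : LocallyCompactSpace SL(2, ℝ) :=
  haveI : LocallyCompactSpace (Matrix (Fin 2) (Fin 2) ℝ) :=
    inferInstanceAs (LocallyCompactSpace (Fin 2 → Fin 2 → ℝ))
  (Matrix.SpecialLinearGroup.isClosedEmbedding_val (n := Fin 2) (R := ℝ)).locallyCompactSpace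

/-- The diagonal matrix `diag (e^{t/2}, e^{-t/2})`. -/
def geodesicMatrix (t : ℝ) : SL(2, ℝ) :=
  ⟨!![Real.exp (t / 2), 0; 0, Real.exp (-(t / 2))], by
    rw [Matrix.det_fin_two_of, ← Real.exp_add]; simp⟩

/-- The lower triangular unipotent matrix `(1, 0; -s, 1)`. -/
def unstableMatrix (s : ℝ) : SL(2, ℝ) :=
  ⟨!![1, 0; -s, 1], by rw [Matrix.det_fin_two_of]; simp⟩

/-- The upper triangular unipotent matrix `(1, s; 0, 1)`. -/
def stableMatrix (s : ℝ) : SL(2, ℝ) :=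
  ⟨!![1, s; 0, 1], by rw [Matrix.det_fin_two_of]; simp⟩

/-! ### The unit tangent bundle, the surface and the flows -/

/-- The unit tangent bundle `𝒳 = Γ \ SL(2, ℝ)`; its points are the cosets `Γ g`. -/
def UnitTangent (Γ : Subgroup SL(2, ℝ)) : Type :=
  MulAction.orbitRel.Quotient Γ SL(2, ℝ)

/-- The surface `𝒴 = Γ \ ℍ`. -/
def Surface (Γ : Subgroup SL(2, ℝ)) : Type :=
  MulAction.orbitRel.Quotient Γ UpperHalfPlane

variable {Γ : Subgroup SL(2, ℝ)}

instance instTopologicalSpaceUnitTangent : TopologicalSpace (UnitTangent Γ) :=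
  inferInstanceAs (TopologicalSpace (MulAction.orbitRel.Quotient Γ SL(2, ℝ)))

instance instMeasurableSpaceUnitTangent : MeasurableSpace (UnitTangent Γ) := borel _

instance instBorelSpaceUnitTangent : BorelSpace (UnitTangent Γ) := ⟨rfl⟩

/-- The coset `Γ g`. -/
def UnitTangent.mk (Γ : Subgroup SL(2, ℝ)) (g : SL(2, ℝ)) : UnitTangent Γ :=
  Quotient.mk (MulAction.orbitRel Γ SL(2, ℝ)) g

/-- Right multiplication `Γ g ↦ Γ g h`. -/
def rightMul (h : SL(2, ℝ)) : UnitTangent Γ → UnitTangent Γ :=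
  Quotient.map (fun g : SL(2, ℝ) => g * h) (by
    rintro a b ⟨γ, rfl⟩
    exact ⟨γ, by simp [Subgroup.smul_def, mul_assoc]⟩)

/-- The geodesic flow `φ_t`. -/
def geodesicFlow (t : ℝ) : UnitTangent Γ → UnitTangent Γ := rightMul (geodesicMatrix t)

/-- The unstable horocycle flow `h_s^+`. -/
def unstableFlow (s : ℝ) : UnitTangent Γ → UnitTangent Γ := rightMul (unstableMatrix s)

/-- The stable horocycle flow `h_s^-`. -/
def stableFlow (s : ℝ) : UnitTangent Γ → UnitTangent Γ := rightMul (stableMatrix s)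

/-- The natural projection `π : 𝒳 → 𝒴`, `Γ g ↦ Γ (g • i)`. -/
def proj : UnitTangent Γ → Surface Γ :=
  Quotient.map (fun g : SL(2, ℝ) => g • UpperHalfPlane.I) (by
    rintro a b ⟨γ, rfl⟩
    exact ⟨γ, by simp [Subgroup.smul_def, mul_smul]⟩)

/-- The Liouville measure on `𝒳`: Haar measure on a fundamental domain `F` of `Γ` in `SL(2, ℝ)`,
projected to `𝒳` and normalised to total mass one. -/
def liouville (Γ : Subgroup SL(2, ℝ)) (F : Set SL(2, ℝ)) : Measure (UnitTangent Γ) :=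
  (Measure.haar F)⁻¹ • (Measure.haar.restrict F).map (UnitTangent.mk Γ)

/-- A Borel measure `ν` on `𝒳` is admissible if `ν (φ_t E) → μ E` as `t → ∞` for every Borel set
`E` whose boundary is a `μ`-null set. -/
def IsAdmissible (μ ν : Measure (UnitTangent Γ)) : Prop :=
  ∀ E : Set (UnitTangent Γ), MeasurableSet E → μ (frontier E) = 0 →
    Tendsto (fun t : ℝ => ν (geodesicFlow t '' E)) atTop (𝓝 (μ E))

/-! ### Cusps and sections -/

/-- The boundary point `g⁻¹ • ∞`, which `g` maps to `∞`. -/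
def cuspOf (g : SL(2, ℝ)) : OnePoint ℝ :=
  Matrix.SpecialLinearGroup.toGL g⁻¹ • (OnePoint.infty : OnePoint ℝ)

/-- `g 0, …, g (K - 1)` are scaling matrices for the cusps of `Γ`: the points `(g κ)⁻¹ • ∞`
represent every `Γ`-equivalence class of cusps exactly once, and `g κ` maps its cusp to a cusp of
width one at infinity. -/
structure IsCuspScaling (Γ : Subgroup SL(2, ℝ)) {K : ℕ} (g : Fin K → SL(2, ℝ)) : Prop where
  width_one : ∀ (κ : Fin K) (s : ℝ),
    (g κ)⁻¹ * stableMatrix s * g κ ∈ Γ ↔ ∃ m : ℤ, s = m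
  inequivalent : ∀ κ ℓ : Fin K, κ ≠ ℓ → ∀ γ ∈ Γ,
    Matrix.SpecialLinearGroup.toGL γ • cuspOf (g κ) ≠ cuspOf (g ℓ)
  complete : ∀ c : OnePoint ℝ, IsCusp c (Γ.map Matrix.SpecialLinearGroup.toGL) →
    ∃ κ : Fin K, ∃ γ ∈ Γ, Matrix.SpecialLinearGroup.toGL γ • cuspOf (g κ) = c

variable {K : ℕ}

/-- The base point `x_κ = Γ (g κ)⁻¹` on the closed stable horocycle of length one around the
cusp `κ`. -/
def basePoint (Γ : Subgroup SL(2, ℝ)) (g : Fin K → SL(2, ℝ)) (κ : Fin K) : UnitTangent Γ :=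
  UnitTangent.mk Γ (g κ)⁻¹

/-- The closed stable horocycle `𝒞_κ` of length one. -/
def closedHorocycle (Γ : Subgroup SL(2, ℝ)) (g : Fin K → SL(2, ℝ)) (κ : Fin K) :
    Set (UnitTangent Γ) :=
  Set.range fun s : ℝ => stableFlow s (basePoint Γ g κ)

/-- The section `ℋ_κ(R) = {φ_t(𝒞_κ) : t ≥ R}`. -/
def cuspSection (Γ : Subgroup SL(2, ℝ)) (g : Fin K → SL(2, ℝ)) (κ : Fin K) (R : ℝ) :
    Set (UnitTangent Γ) :=
  ⋃ t ∈ Set.Ici R, geodesicFlow t '' closedHorocycle Γ g κ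

/-- The multi-cusp section `ℋ(σ, R) = ⋃_κ ℋ_κ(σ_κ + R)`. -/
def multiSection (Γ : Subgroup SL(2, ℝ)) (g : Fin K → SL(2, ℝ)) (σ : Fin K → ℝ) (R : ℝ) :
    Set (UnitTangent Γ) :=
  ⋃ κ, cuspSection Γ g κ (σ κ + R)

/-- The parameter space `Σ^K(σ)` of triples `(s, t, κ)` with `s ∈ [0, 1)` and `t ≥ σ_κ`. -/
def sectionParams (σ : Fin K → ℝ) : Set (ℝ × ℝ × Fin K) :=
  {w | w.1 ∈ Set.Ico 0 1 ∧ σ w.2.2 ≤ w.2.1}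

/-- The parametrisation `ι(s, t, κ) = φ_t (h_s^- x_κ)`; it maps `Σ^K(σ)` onto `ℋ(σ, 0)`. -/
def sectionMap (Γ : Subgroup SL(2, ℝ)) (g : Fin K → SL(2, ℝ)) (w : ℝ × ℝ × Fin K) :
    UnitTangent Γ :=
  geodesicFlow w.2.1 (stableFlow w.1 (basePoint Γ g w.2.2))

/-! ### Heights -/

/-- The relative height `t - σ_κ` of the point `x = ι(s, t, κ)` of the section `ℋ(σ, 0)`, and
`⊥` off the section. -/
def relHeight (g : Fin K → SL(2, ℝ)) (σ : Fin K → ℝ) (x : UnitTangent Γ) : EReal :=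
  ⨆ w ∈ {w | w ∈ sectionParams σ ∧ sectionMap Γ g w = x}, ((w.2.1 - σ w.2.2 : ℝ) : EReal)

/-- The relative height of a point `y` of the surface: the height of its lift to the section
`ℋ(σ, 0)`, the highest one if there are several (there is at most one when all `σ_κ` are
large), and `⊥` if `y` is not in the projected section. -/
def relHeightSurface (g : Fin K → SL(2, ℝ)) (σ : Fin K → ℝ) (y : Surface Γ) : EReal :=
  ⨆ x ∈ {x | x ∈ multiSection Γ g σ 0 ∧ proj x = y}, relHeight g σ x

/-! ### Hitting times, return times and the limit density -/

/-- The set `{ξ_1, ξ_2, …}` of hitting times of the section `ℋ(σ, R)` along the unstable horocycle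
orbit of `x`. -/
def hittingTimes (g : Fin K → SL(2, ℝ)) (σ : Fin K → ℝ) (R : ℝ) (x : UnitTangent Γ) : Set ℝ :=
  {r | 0 < r ∧ unstableFlow r x ∈ multiSection Γ g σ R}

/-- The first return time `η_1(s, t, κ, σ)` to `ℋ(σ, 0)`, starting at `ι(s, t, κ)`
(`∞` if there is no return). -/
def returnTime (Γ : Subgroup SL(2, ℝ)) (g : Fin K → SL(2, ℝ)) (σ : Fin K → ℝ)
    (w : ℝ × ℝ × Fin K) : ℝ≥0∞ :=
  ⨅ r ∈ hittingTimes g σ 0 (sectionMap Γ g w), ENNReal.ofReal r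

/-- The first backward return time `η_{-1}(s, t, κ, σ)` to `ℋ(σ, 0)`, starting at `ι(s, t, κ)`
(`∞` if there is no return). -/
def backwardReturnTime (Γ : Subgroup SL(2, ℝ)) (g : Fin K → SL(2, ℝ)) (σ : Fin K → ℝ)
    (w : ℝ × ℝ × Fin K) : ℝ≥0∞ :=
  ⨅ r ∈ {r : ℝ | 0 < r ∧ unstableFlow (-r) (sectionMap Γ g w) ∈ multiSection Γ g σ 0},
    ENNReal.ofReal r

/-- The integral of `f` over `Σ^K(σ)` against `ν_σ(ds, dt, {κ}) = e^{-t} dt ds`. -/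
def sectionIntegral (σ : Fin K → ℝ) (f : ℝ × ℝ × Fin K → ℝ≥0∞) : ℝ≥0∞ :=
  ∑ κ, ∫⁻ s in Set.Ico (0 : ℝ) 1, ∫⁻ t in Set.Ici (σ κ),
    f (s, t, κ) * ENNReal.ofReal (Real.exp (-t))

/-- The mean return time `η̄_1(σ)`. -/
def meanReturnTime (Γ : Subgroup SL(2, ℝ)) (g : Fin K → SL(2, ℝ)) (σ : Fin K → ℝ) : ℝ≥0∞ :=
  sectionIntegral σ (returnTime Γ g σ)

open Classical in
/-- The joint density `Ψ_σ(r, w, κ) = 1(r < η_{-1}(w, κ, σ)) / η̄_1(σ)` of hitting time and impact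
parameter. -/
def jointDensity (Γ : Subgroup SL(2, ℝ)) (g : Fin K → SL(2, ℝ)) (σ : Fin K → ℝ) (r : ℝ)
    (w : ℝ × ℝ × Fin K) : ℝ≥0∞ :=
  (meanReturnTime Γ g σ)⁻¹ *
    (if ENNReal.ofReal r < backwardReturnTime Γ g σ w then 1 else 0)

/-- The hitting time density `Ψ_σ(r)`. -/
def hittingDensity (Γ : Subgroup SL(2, ℝ)) (g : Fin K → SL(2, ℝ)) (σ : Fin K → ℝ) (r : ℝ) : ℝ :=
  (sectionIntegral σ (jointDensity Γ g σ r)).toReal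

/-- The limit density `ρ_σ(s) = e^{-s} Ψ_σ(e^{-s})`. -/
def extremeDensity (Γ : Subgroup SL(2, ℝ)) (g : Fin K → SL(2, ℝ)) (σ : Fin K → ℝ) (s : ℝ) : ℝ :=
  Real.exp (-s) * hittingDensity Γ g σ (Real.exp (-s))

end HorocycleExtremes

end

/-!
The point `Γ x` is `ι(s, t, κ)` exactly when some matrix `g_κ γ x`, `γ ∈ Γ`, has bottom row
`(0, e^{-t/2})`, and the horocycle flow `h_r^+` replaces a bottom row `(a, b)` by `(a - r b, b)`.
Hence the event that the section is hit at height above `H + log T` before time `T` says that one of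
the vectors `(0, 1) g_κ γ x` lies in an explicit region of the plane. The geodesic flow acts on the
plane by diagonal matrices, and applying `φ_{H + log T}` to a fixed event `E`, defined by the
triangle `0 < b < e^{-σ_κ/2}`, `0 < a ≤ e^{-H} b`, yields exactly this event. As the cusp orbits
are discrete and the triangle is bounded and convex, `E` has a null boundary, and admissibility
gives the limit `μ(E)`. The supremum over the projected orbit is squeezed between the event on the
section and the events belonging to slightly thickened triangles: a horocycle orbit which passes
over a point of large height on the surface comes close to the section in the same cusp.

To compute `μ(E)`, note that `E` consists of the points which hit the section within time `e^{-H}`.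
Almost every horocycle orbit hits the section, so the flow boxes over the section, whose length is
the backward return time, tile `𝒳`; in the coordinates `(s, t, r)` Haar measure is proportional to
`e^{-t} ds dt dr`. Integrating `min(e^{-H}, η_{-1})` over the section gives `μ(E)` up to a constant,
which the forward flow boxes identify through the mean return time.
-/

noncomputable section

namespace HorocycleExtremes

/-! ### The group `SL(2, R)` -/

section SpecialLinear

variable {n R : Type*} [Fintype n] [DecidableEq n] [CommRing R]

instance instSecondCountableTopologySpecialLinearGroup [TopologicalSpace R]
    [SecondCountableTopology R] :
    SecondCountableTopology (Matrix.SpecialLinearGroup n R) :=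
  haveI : SecondCountableTopology (Matrix n n R) :=
    inferInstanceAs (SecondCountableTopology (n → n → R))
  (Topology.IsEmbedding.subtypeVal (p := fun A : Matrix n n R => A.det = 1)).secondCountableTopology

theorem continuous_entry [TopologicalSpace R] (i j : n) :
    Continuous fun g : Matrix.SpecialLinearGroup n R => g i j :=
  (continuous_apply_apply i j).comp continuous_subtype_val

theorem mul_entry (g h : SL(2, R)) (i j : Fin 2) :
    (g * h) i j = g i 0 * h 0 j + g i 1 * h 1 j := by
  rw [Matrix.SpecialLinearGroup.coe_mul, Matrix.mul_apply, Fin.sum_univ_two]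

theorem det_entries (g : SL(2, R)) : g 0 0 * g 1 1 - g 0 1 * g 1 0 = 1 := by
  rw [← Matrix.det_fin_two]
  exact g.2

theorem ext_entries {g h : SL(2, R)} (h00 : g 0 0 = h 0 0) (h01 : g 0 1 = h 0 1)
    (h10 : g 1 0 = h 1 0) (h11 : g 1 1 = h 1 1) : g = h := by
  ext i j
  fin_cases i <;> fin_cases j <;> assumption

theorem ext_of_lower_right_ne_zero [NoZeroDivisors R] {g h : SL(2, R)} (h01 : g 0 1 = h 0 1)
    (h10 : g 1 0 = h 1 0) (h11 : g 1 1 = h 1 1) (h0 : g 1 1 ≠ 0) : g = h := by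
  refine ext_entries ?_ h01 h10 h11
  have hg := det_entries g
  have hh := det_entries h
  rw [← h11, ← h10, ← h01] at hh
  exact mul_right_cancel₀ h0 (by linear_combination hg - hh)

theorem inv_entries (g : SL(2, R)) :
    g⁻¹ 0 0 = g 1 1 ∧ g⁻¹ 0 1 = -g 0 1 ∧ g⁻¹ 1 0 = -g 1 0 ∧ g⁻¹ 1 1 = g 0 0 := by
  rw [Matrix.SpecialLinearGroup.coe_inv, Matrix.adjugate_fin_two]
  simp

end SpecialLinear

section Entries

variable (s t : ℝ)

@[simp] theorem geodesicMatrix_zero_zero : geodesicMatrix t 0 0 = Real.exp (t / 2) := rfl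

@[simp] theorem geodesicMatrix_zero_one : geodesicMatrix t 0 1 = 0 := rfl

@[simp] theorem geodesicMatrix_one_zero : geodesicMatrix t 1 0 = 0 := rfl

@[simp] theorem geodesicMatrix_one_one : geodesicMatrix t 1 1 = Real.exp (-(t / 2)) := rfl

@[simp] theorem unstableMatrix_zero_zero : unstableMatrix s 0 0 = 1 := rfl

@[simp] theorem unstableMatrix_zero_one : unstableMatrix s 0 1 = 0 := rfl

@[simp] theorem unstableMatrix_one_zero : unstableMatrix s 1 0 = -s := rfl

@[simp] theorem unstableMatrix_one_one : unstableMatrix s 1 1 = 1 := rfl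

@[simp] theorem stableMatrix_zero_zero : stableMatrix s 0 0 = 1 := rfl

@[simp] theorem stableMatrix_zero_one : stableMatrix s 0 1 = s := rfl

@[simp] theorem stableMatrix_one_zero : stableMatrix s 1 0 = 0 := rfl

@[simp] theorem stableMatrix_one_one : stableMatrix s 1 1 = 1 := rfl

theorem geodesicMatrix_neg : geodesicMatrix (-t) = (geodesicMatrix t)⁻¹ := by
  obtain ⟨h00, h01, h10, h11⟩ := inv_entries (geodesicMatrix t)
  exact ext_entries (by simp [h00, neg_div]) (by simp [h01]) (by simp [h10])
    (by simp [h11, neg_div])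

theorem unstableMatrix_zero : unstableMatrix 0 = 1 :=
  ext_entries rfl rfl neg_zero rfl

end Entries

theorem measurable_entry (i j : Fin 2) : Measurable fun g : SL(2, ℝ) => g i j :=
  (continuous_entry i j).measurable

theorem measurable_of_entries {α : Type*} [MeasurableSpace α] {f : α → SL(2, ℝ)}
    (hf : ∀ i j, Measurable fun a => f a i j) : Measurable f := by
  have hind : IsInducing fun g : SL(2, ℝ) => (fun i j => g i j : Fin 2 → Fin 2 → ℝ) :=
    (Matrix.SpecialLinearGroup.isClosedEmbedding_val (n := Fin 2) (R := ℝ)).isInducing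
  have hval : Measurable fun a => (fun i j => f a i j : Fin 2 → Fin 2 → ℝ) :=
    measurable_pi_iff.2 fun i => measurable_pi_iff.2 fun j => hf i j
  refine measurable_of_isOpen fun U hU => ?_
  obtain ⟨V, hV, rfl⟩ := hind.isOpen_iff.1 hU
  exact hval hV.measurableSet

/-! ### The action of `SL(2, R)` on row vectors -/

/-- The bottom row of a matrix as a point of the plane; it determines the coset modulo the upper
triangular unipotent group on the left. -/
def bottomRow (g : SL(2, ℝ)) : ℝ × ℝ := (g 1 0, g 1 1)

/-- The linear action of `h` on row vectors, by multiplication on the right. -/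
def rowAct (h : SL(2, ℝ)) (v : ℝ × ℝ) : ℝ × ℝ :=
  (v.1 * h 0 0 + v.2 * h 1 0, v.1 * h 0 1 + v.2 * h 1 1)

theorem bottomRow_mul (g h : SL(2, ℝ)) : bottomRow (g * h) = rowAct h (bottomRow g) := by
  simp [bottomRow, rowAct, mul_entry]

theorem continuous_bottomRow : Continuous bottomRow :=
  (continuous_entry 1 0).prodMk (continuous_entry 1 1)

theorem bottomRow_ne_zero (g : SL(2, ℝ)) : bottomRow g ≠ 0 := fun h => by
  have h10 : g 1 0 = 0 := congrArg Prod.fst h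
  have h11 : g 1 1 = 0 := congrArg Prod.snd h
  simpa [h10, h11] using det_entries g

theorem rowAct_one (v : ℝ × ℝ) : rowAct 1 v = v := by simp [rowAct]

theorem rowAct_mul (g h : SL(2, ℝ)) (v : ℝ × ℝ) : rowAct (g * h) v = rowAct h (rowAct g v) := by
  ext <;> simp only [rowAct, mul_entry] <;> ring

theorem rowAct_unstableMatrix (r : ℝ) (v : ℝ × ℝ) :
    rowAct (unstableMatrix r) v = (v.1 - r * v.2, v.2) := by
  ext <;> simp [rowAct]
  ring

theorem rowAct_geodesicMatrix (t : ℝ) (v : ℝ × ℝ) :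
    rowAct (geodesicMatrix t) v = (v.1 * Real.exp (t / 2), v.2 * Real.exp (-(t / 2))) := by
  ext <;> simp [rowAct]

theorem continuous_rowAct : Continuous fun p : SL(2, ℝ) × (ℝ × ℝ) => rowAct p.1 p.2 := by
  have h := fun i j => (continuous_entry (n := Fin 2) (R := ℝ) i j).comp
    (continuous_fst (Y := ℝ × ℝ))
  simp only [Function.comp_def] at h
  unfold rowAct
  fun_prop

theorem measurePreserving_rowAct (h : SL(2, ℝ)) :
    MeasurePreserving (rowAct h) volume volume := by
  let A : ℝ × ℝ →ₗ[ℝ] ℝ × ℝ := Matrix.toLin (Module.Basis.finTwoProd ℝ) (Module.Basis.finTwoProd ℝ)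
    !![h 0 0, h 1 0; h 0 1, h 1 1]
  have hA : rowAct h = A := by
    ext v <;> simp only [A, Matrix.toLin_finTwoProd_apply, rowAct] <;> ring
  have hdet : LinearMap.det A = 1 := by
    simp only [A, LinearMap.det_toLin, Matrix.det_fin_two_of]
    linarith [det_entries h]
  refine ⟨(continuous_rowAct.comp (Continuous.prodMk_right h)).measurable, ?_⟩
  rw [hA, Measure.map_linearMap_addHaar_eq_smul_addHaar _ (by rw [hdet]; exact one_ne_zero), hdet]
  simp

/-! ### Haar measure in row coordinates -/

section Haar

variable {G : Type*} [Group G] [MeasurableSpace G]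

theorem isMulRightInvariant_of_commutator_eq_top [TopologicalSpace G] [IsTopologicalGroup G]
    [LocallyCompactSpace G] [BorelSpace G] (hG : commutator G = ⊤) (μ : Measure G)
    [μ.IsHaarMeasure] [μ.InnerRegular] : μ.IsMulRightInvariant := by
  have htrivial : ∀ g : G, Measure.modularCharacter g = 1 := fun g => by
    let χ : G →* NNRealˣ := (Measure.modularCharacter (G := G)).toHomUnits
    have hg : g ∈ χ.ker := Abelianization.commutator_subset_ker χ (hG ▸ Subgroup.mem_top g)
    simpa [χ] using congrArg Units.val (MonoidHom.mem_ker.1 hg)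
  exact ⟨fun g => by
    rw [Measure.map_right_mul_eq_modularCharacterFun_smul,
      show Measure.modularCharacterFun g = 1 from htrivial g, one_smul]⟩

theorem eq_div_smul_of_isMulRightInvariant [MeasurableMul₂ G] [MeasurableInv G] (μ ν : Measure G)
    [SigmaFinite μ] [SigmaFinite ν] [μ.IsMulRightInvariant] [ν.IsMulRightInvariant] {s : Set G}
    (h0 : ν s ≠ 0) (htop : ν s ≠ ∞) : μ = (μ s / ν s) • ν := by
  have h := measure_eq_div_smul μ.inv ν.inv (s := s⁻¹) (by simpa using h0) (by simpa using htop)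
  ext t -
  simpa using congrArg (fun m : Measure G => m t⁻¹) h

end Haar

instance instIsMulRightInvariantHaarSL :
    (Measure.haar : Measure SL(2, ℝ)).IsMulRightInvariant :=
  isMulRightInvariant_of_commutator_eq_top
    (Matrix.SL2.commutator_eq_top (a := (2 : ℝ)) two_ne_zero (by norm_num)) _

/-- The matrix with bottom row `v` and upper right entry `s * v.2`, which exists and is unique if
`v.2 ≠ 0`; for `v.2 = 0` the value is the identity. -/
def rowMatrix (v : ℝ × ℝ) (s : ℝ) : SL(2, ℝ) :=
  if h : v.2 = 0 then 1 else
    ⟨!![s * v.1 + v.2⁻¹, s * v.2; v.1, v.2], by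
      rw [Matrix.det_fin_two_of]; field_simp; ring⟩

theorem bottomRow_rowMatrix {v : ℝ × ℝ} (h : v.2 ≠ 0) (s : ℝ) : bottomRow (rowMatrix v s) = v := by
  simp [bottomRow, rowMatrix, h]

theorem rowMatrix_one_one {v : ℝ × ℝ} (h : v.2 ≠ 0) (s : ℝ) : rowMatrix v s 1 1 = v.2 :=
  congrArg Prod.snd (bottomRow_rowMatrix h s)

theorem rowMatrix_zero_one {v : ℝ × ℝ} (h : v.2 ≠ 0) (s : ℝ) :
    rowMatrix v s 0 1 = s * v.2 := by simp [rowMatrix, h]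

theorem rowMatrix_zero_zero {v : ℝ × ℝ} (h : v.2 ≠ 0) (s : ℝ) :
    rowMatrix v s 0 0 = s * v.1 + v.2⁻¹ := by simp [rowMatrix, h]

theorem measurable_rowMatrix : Measurable fun p : (ℝ × ℝ) × ℝ => rowMatrix p.1 p.2 := by
  have hentry : ∀ i j, (fun p : (ℝ × ℝ) × ℝ => rowMatrix p.1 p.2 i j) = fun p =>
      if p.1.2 = 0 then (1 : SL(2, ℝ)) i j
      else !![p.2 * p.1.1 + p.1.2⁻¹, p.2 * p.1.2; p.1.1, p.1.2] i j := fun i j => by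
    ext p
    by_cases h : p.1.2 = 0 <;> simp [rowMatrix, h]
  refine measurable_of_entries fun i j => ?_
  rw [hentry]
  refine Measurable.ite (measurableSet_eq_fun (by fun_prop) (by fun_prop)) (by fun_prop) ?_
  fin_cases i <;> fin_cases j <;>
    simp only [Fin.mk_one, Fin.isValue, Fin.zero_eta, Matrix.of_apply, Matrix.cons_val',
      Matrix.cons_val_zero, Matrix.cons_val_fin_one, Matrix.cons_val_one] <;>
    fun_prop

theorem eq_rowMatrix {g : SL(2, ℝ)} (h : g 1 1 ≠ 0) :
    g = rowMatrix (bottomRow g) (g 0 1 / g 1 1) := by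
  have hrow := bottomRow_rowMatrix (v := bottomRow g) h (g 0 1 / g 1 1)
  refine ext_of_lower_right_ne_zero ?_ (congrArg Prod.fst hrow).symm
    (congrArg Prod.snd hrow).symm h
  rw [rowMatrix_zero_one h]
  exact (div_mul_cancel₀ _ h).symm

theorem rowMatrix_mul {v : ℝ × ℝ} (h : SL(2, ℝ)) (s : ℝ) (hv : v.2 ≠ 0)
    (hw : (rowAct h v).2 ≠ 0) :
    rowMatrix v s * h = rowMatrix (rowAct h v) (h 0 1 / (v.2 * (rowAct h v).2) + s) := by
  have hrow : bottomRow (rowMatrix v s * h) = rowAct h v := by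
    rw [bottomRow_mul, bottomRow_rowMatrix hv]
  have h11 : (rowMatrix v s * h) 1 1 = (rowAct h v).2 := congrArg Prod.snd hrow
  rw [eq_rowMatrix (g := rowMatrix v s * h) (by rwa [h11]), hrow, h11]
  congr 1
  rw [mul_entry, rowMatrix_zero_zero hv, rowMatrix_zero_one hv]
  field_simp
  simp only [rowAct]
  ring

theorem ae_snd_ne_zero : ∀ᵐ v : ℝ × ℝ, v.2 ≠ 0 :=
  Measure.quasiMeasurePreserving_snd.ae (Measure.ae_ne volume 0)

theorem ae_fst_snd_ne_zero : ∀ᵐ p : (ℝ × ℝ) × ℝ, p.1.2 ≠ 0 :=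
  Measure.quasiMeasurePreserving_fst.ae ae_snd_ne_zero

/-- Lebesgue measure in the coordinates of `rowMatrix`: a concrete model of Haar measure. -/
def coordMeasure : Measure SL(2, ℝ) :=
  (volume : Measure ((ℝ × ℝ) × ℝ)).map fun p => rowMatrix p.1 p.2

theorem measurePreserving_rowCoord :
    MeasurePreserving (fun g : SL(2, ℝ) => (bottomRow g, g 0 1 / g 1 1)) coordMeasure volume := by
  have hmeas : Measurable fun g : SL(2, ℝ) => (bottomRow g, g 0 1 / g 1 1) :=
    continuous_bottomRow.measurable.prodMk ((measurable_entry 0 1).div (measurable_entry 1 1))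
  refine ⟨hmeas, ?_⟩
  rw [coordMeasure, Measure.map_map hmeas measurable_rowMatrix]
  conv_rhs => rw [← Measure.map_id (μ := (volume : Measure ((ℝ × ℝ) × ℝ)))]
  refine Measure.map_congr (ae_fst_snd_ne_zero.mono fun p hp => ?_)
  simp only [Function.comp_apply, bottomRow_rowMatrix hp, rowMatrix_zero_one hp,
    rowMatrix_one_one hp, mul_div_cancel_right₀ _ hp, id]

instance instSigmaFiniteCoordMeasure : SigmaFinite coordMeasure :=
  .of_map _ measurePreserving_rowCoord.aemeasurable <| by
    rw [measurePreserving_rowCoord.map_eq]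
    infer_instance

instance instIsMulRightInvariantCoordMeasure : coordMeasure.IsMulRightInvariant := by
  refine ⟨fun h => ?_⟩
  -- In row coordinates, right multiplication acts linearly on `v` and translates `s`.
  have hskew : MeasurePreserving
      (fun p : (ℝ × ℝ) × ℝ => (rowAct h p.1, h 0 1 / (p.1.2 * (rowAct h p.1).2) + p.2)) := by
    refine (measurePreserving_rowAct h).skew_product
      (g := fun v s => h 0 1 / (v.2 * (rowAct h v).2) + s) ?_
      (ae_of_all _ fun v => (measurePreserving_add_left volume _).map_eq)
    have := (measurePreserving_rowAct h).measurable
    simp only [Function.uncurry_def]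
    fun_prop
  have hne : ∀ᵐ p : (ℝ × ℝ) × ℝ, (rowAct h p.1).2 ≠ 0 :=
    Measure.quasiMeasurePreserving_fst.ae
      ((measurePreserving_rowAct h).quasiMeasurePreserving.ae ae_snd_ne_zero)
  rw [coordMeasure, Measure.map_map (measurable_mul_const h) measurable_rowMatrix]
  conv_rhs => rw [← hskew.map_eq, Measure.map_map measurable_rowMatrix hskew.measurable]
  refine Measure.map_congr ?_
  filter_upwards [ae_fst_snd_ne_zero, hne] with p hp hph
  exact rowMatrix_mul h p.2 hp hph

theorem exists_haar_eq_smul_coordMeasure : ∃ c : ℝ≥0∞, c ≠ 0 ∧ c ≠ ∞ ∧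
    (Measure.haar : Measure SL(2, ℝ)) = c • coordMeasure := by
  obtain ⟨B, hB⟩ : ∃ B, coordMeasure B = 1 := by
    refine ⟨_, (measurePreserving_rowCoord.measure_preimage
      (s := (Set.Icc 0 1 ×ˢ Set.Icc 0 1) ×ˢ Set.Icc 0 1) ?_).trans ?_⟩
    · exact ((measurableSet_Icc.prod measurableSet_Icc).prod measurableSet_Icc).nullMeasurableSet
    · rw [Measure.volume_eq_prod, Measure.prod_prod, Measure.volume_eq_prod, Measure.prod_prod]
      simp
  have hhaar := eq_div_smul_of_isMulRightInvariant (Measure.haar : Measure SL(2, ℝ)) coordMeasure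
    (s := B) (by simp [hB]) (by simp [hB])
  refine ⟨_, fun h0 => ?_, fun htop => ?_, hhaar⟩
  · rw [h0, zero_smul] at hhaar
    exact NeZero.ne _ hhaar
  · rw [htop] at hhaar
    obtain ⟨C, hC, hC1⟩ := exists_compact_mem_nhds (1 : SL(2, ℝ))
    have hfin := hC.measure_lt_top (μ := (Measure.haar : Measure SL(2, ℝ)))
    have hpos := Measure.measure_pos_of_mem_nhds (Measure.haar : Measure SL(2, ℝ)) hC1
    rw [hhaar, Measure.smul_apply, smul_eq_mul] at hfin hpos
    rw [ENNReal.top_mul (right_ne_zero_of_mul hpos.ne')] at hfin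
    exact hfin.false

theorem quasiMeasurePreserving_bottomRow :
    Measure.QuasiMeasurePreserving bottomRow Measure.haar volume := by
  obtain ⟨c, -, -, hc⟩ := exists_haar_eq_smul_coordMeasure
  rw [hc]
  exact (Measure.quasiMeasurePreserving_fst.comp
    measurePreserving_rowCoord.quasiMeasurePreserving).mono_left
      (Measure.smul_absolutelyContinuous)

/-! ### Haar measure in flow-box coordinates -/

/-- The point reached from the section coordinates `(s, t)` by flowing back for time `r` along the
unstable horocycle. -/
def flowBox (s t r : ℝ) : SL(2, ℝ) := stableMatrix s * geodesicMatrix t * unstableMatrix (-r)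

theorem flowBox_zero_right (s t : ℝ) : flowBox s t 0 = stableMatrix s * geodesicMatrix t := by
  rw [flowBox, neg_zero, unstableMatrix_zero, mul_one]

theorem flowBox_eq_mul (s t r : ℝ) : flowBox s t r = flowBox s t 0 * unstableMatrix (-r) := by
  rw [flowBox_zero_right, flowBox]

theorem bottomRow_flowBox (s t r : ℝ) :
    bottomRow (flowBox s t r) = (r * Real.exp (-(t / 2)), Real.exp (-(t / 2))) := by
  simp [bottomRow, flowBox, mul_entry, mul_comm]

theorem flowBox_one_one (s t r : ℝ) : flowBox s t r 1 1 = Real.exp (-(t / 2)) :=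
  congrArg Prod.snd (bottomRow_flowBox s t r)

theorem flowBox_zero_one (s t r : ℝ) : flowBox s t r 0 1 = s * Real.exp (-(t / 2)) := by
  simp [flowBox, mul_entry]

theorem flowBox_eq_rowMatrix (s t r : ℝ) :
    flowBox s t r = rowMatrix (r * Real.exp (-(t / 2)), Real.exp (-(t / 2))) s := by
  have h11 : flowBox s t r 1 1 ≠ 0 := by rw [flowBox_one_one]; exact (Real.exp_pos _).ne'
  rw [eq_rowMatrix h11, bottomRow_flowBox, flowBox_zero_one, flowBox_one_one,
    mul_div_cancel_right₀ _ (Real.exp_pos _).ne']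

theorem eq_flowBox {g : SL(2, ℝ)} (h : 0 < g 1 1) :
    g = flowBox (g 0 1 / g 1 1) (-(2 * Real.log (g 1 1))) (g 1 0 / g 1 1) := by
  have hexp : Real.exp (-(-(2 * Real.log (g 1 1)) / 2)) = g 1 1 := by
    rw [show -(-(2 * Real.log (g 1 1)) / 2) = Real.log (g 1 1) by ring, Real.exp_log h]
  rw [flowBox_eq_rowMatrix, hexp, div_mul_cancel₀ _ h.ne']
  exact eq_rowMatrix h.ne'

theorem measurable_flowBox : Measurable fun p : ℝ × ℝ × ℝ => flowBox p.1 p.2.1 p.2.2 := by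
  simp_rw [flowBox_eq_rowMatrix]
  exact measurable_rowMatrix.comp (f := fun p : ℝ × ℝ × ℝ =>
    ((p.2.2 * Real.exp (-(p.2.1 / 2)), Real.exp (-(p.2.1 / 2))), p.1)) (by fun_prop)

theorem lintegral_mul_right_substitution {y : ℝ} (hy : y ≠ 0) (f : ℝ → ℝ≥0∞) :
    ∫⁻ x, f x = ENNReal.ofReal |y| * ∫⁻ r, f (r * y) := by
  conv_lhs => rw [← Real.smul_map_volume_mul_right hy]
  rw [lintegral_smul_measure, smul_eq_mul]
  congr 1
  exact lintegral_map_equiv f (Homeomorph.mulRight₀ y hy).toMeasurableEquiv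

theorem setLIntegral_exp_mul_substitution {k : ℝ} (hk : k ≠ 0) {S : Set ℝ} (hS : MeasurableSet S)
    (f : ℝ → ℝ≥0∞) :
    ∫⁻ y in (fun t => Real.exp (k * t)) '' S, f y =
      ∫⁻ t in S, ENNReal.ofReal (|k| * Real.exp (k * t)) * f (Real.exp (k * t)) := by
  have hderiv : ∀ t ∈ S, HasDerivWithinAt (fun t => Real.exp (k * t)) (Real.exp (k * t) * k) S t :=
    fun t _ => (by simpa using ((hasDerivAt_id t).const_mul k).exp :
      HasDerivAt (fun t => Real.exp (k * t)) (Real.exp (k * t) * k) t).hasDerivWithinAt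
  have hinj : Set.InjOn (fun t => Real.exp (k * t)) S := fun a _ b _ hab =>
    mul_left_cancel₀ hk (Real.exp_injective hab)
  rw [lintegral_image_eq_lintegral_abs_deriv_mul hS hderiv hinj]
  simp only [abs_mul, Real.abs_exp, mul_comm]

theorem image_exp_mul_univ {k : ℝ} (hk : k ≠ 0) :
    (fun t => Real.exp (k * t)) '' Set.univ = Set.Ioi 0 := by
  rw [← Real.range_exp, Set.image_univ]
  exact (mul_left_surjective₀ hk).range_comp Real.exp

theorem lintegral_coordMeasure_lower_right_pos {f : SL(2, ℝ) → ℝ≥0∞} (hf : Measurable f) :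
    ∫⁻ g in {g | 0 < g 1 1}, f g ∂coordMeasure =
      ∫⁻ s, ∫⁻ y in Set.Ioi 0, ∫⁻ x, f (rowMatrix (x, y) s) := by
  have hpos : MeasurableSet {g : SL(2, ℝ) | 0 < g 1 1} :=
    measurableSet_lt measurable_const (measurable_entry 1 1)
  have hF : Measurable fun p : (ℝ × ℝ) × ℝ =>
      Set.indicator {g : SL(2, ℝ) | 0 < g 1 1} f (rowMatrix p.1 p.2) :=
    (hf.indicator hpos).comp measurable_rowMatrix
  rw [← lintegral_indicator hpos, coordMeasure,
    lintegral_map (hf.indicator hpos) measurable_rowMatrix, Measure.volume_eq_prod,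
    lintegral_prod_symm _ hF.aemeasurable]
  refine lintegral_congr fun s => ?_
  have hFs : Measurable fun v => Set.indicator {g : SL(2, ℝ) | 0 < g 1 1} f (rowMatrix v s) :=
    hF.comp measurable_prodMk_right
  rw [Measure.volume_eq_prod, lintegral_prod_symm _ hFs.aemeasurable,
    ← lintegral_indicator measurableSet_Ioi]
  refine lintegral_congr_ae ((Measure.ae_ne volume (0 : ℝ)).mono fun y hy => ?_)
  by_cases h : 0 < y <;> simp [Set.indicator, rowMatrix_one_one (v := (_, y)) hy, h]

theorem exists_lintegral_haar_eq_flowBox : ∃ c : ℝ≥0∞, c ≠ 0 ∧ c ≠ ∞ ∧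
    ∀ f : SL(2, ℝ) → ℝ≥0∞, Measurable f →
      ∫⁻ g in {g | 0 < g 1 1}, f g ∂Measure.haar =
        c * ∫⁻ s, ∫⁻ t, ∫⁻ r, f (flowBox s t r) * ENNReal.ofReal (Real.exp (-t)) := by
  obtain ⟨c, hc0, hctop, hc⟩ := exists_haar_eq_smul_coordMeasure
  refine ⟨c * ENNReal.ofReal (1 / 2), mul_ne_zero hc0 (by simp), ENNReal.mul_ne_top hctop (by simp),
    fun f hf => ?_⟩
  rw [hc, Measure.restrict_smul, lintegral_smul_measure, smul_eq_mul,
    lintegral_coordMeasure_lower_right_pos hf, mul_assoc]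
  congr 1
  rw [← lintegral_const_mul' _ _ ENNReal.ofReal_ne_top]
  refine lintegral_congr fun s => ?_
  have hk : (-(1 / 2) : ℝ) ≠ 0 := by norm_num
  rw [← image_exp_mul_univ hk, setLIntegral_exp_mul_substitution hk MeasurableSet.univ,
    setLIntegral_univ, ← lintegral_const_mul' _ _ ENNReal.ofReal_ne_top]
  refine lintegral_congr fun t => ?_
  rw [show -(1 / 2) * t = -(t / 2) by ring,
    lintegral_mul_right_substitution (Real.exp_pos (-(t / 2))).ne',
    lintegral_mul_const' _ _ ENNReal.ofReal_ne_top, mul_comm (∫⁻ r, f (flowBox s t r)),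
    ← mul_assoc, ← mul_assoc, ← ENNReal.ofReal_mul (by positivity),
    ← ENNReal.ofReal_mul (by positivity), Real.abs_exp, mul_assoc |_|, ← Real.exp_add]
  simp only [flowBox_eq_rowMatrix]
  congr 2
  rw [abs_neg, abs_of_pos one_half_pos]
  ring_nf

/-! ### Discreteness of the cusp orbits -/

/-- The conjugate `P⁻¹ (1, s; 0, 1) P` for any `P` with bottom row `v`. -/
def parabolic (s : ℝ) (v : ℝ × ℝ) : SL(2, ℝ) :=
  ⟨!![1 + s * (v.1 * v.2), s * (v.2 * v.2); -(s * (v.1 * v.1)), 1 - s * (v.1 * v.2)], by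
    rw [Matrix.det_fin_two_of]; ring⟩

theorem inv_mul_stableMatrix_mul (P : SL(2, ℝ)) (s : ℝ) :
    P⁻¹ * stableMatrix s * P = parabolic s (bottomRow P) := by
  obtain ⟨h00, h01, h10, h11⟩ := inv_entries P
  have hdet := det_entries P
  refine ext_entries ?_ ?_ ?_ ?_ <;>
    simp only [mul_entry, h00, h01, h10, h11, stableMatrix_zero_zero, stableMatrix_zero_one,
      stableMatrix_one_zero, stableMatrix_one_one, parabolic, bottomRow, Matrix.of_apply,
      Matrix.cons_val]
  · linear_combination hdet
  · ring
  · ring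
  · linear_combination hdet

theorem parabolic_of_fst_eq_zero {v : ℝ × ℝ} (h : v.1 = 0) (s : ℝ) :
    parabolic s v = stableMatrix (s * (v.2 * v.2)) :=
  ext_entries (by simp [parabolic, h]) (by simp [parabolic]) (by simp [parabolic, h])
    (by simp [parabolic, h])

theorem continuous_parabolic (s : ℝ) : Continuous (parabolic s) := by
  refine Continuous.subtype_mk (continuous_matrix fun i j => ?_) _
  fin_cases i <;> fin_cases j <;>
    simp only [Fin.mk_one, Fin.isValue, Fin.zero_eta, Matrix.of_apply, Matrix.cons_val',
      Matrix.cons_val_zero, Matrix.cons_val_fin_one, Matrix.cons_val_one] <;>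
    fun_prop

theorem finite_preimage_parabolic {s : ℝ} (hs : s ≠ 0) (A : SL(2, ℝ)) :
    (parabolic s ⁻¹' {A}).Finite := by
  have hsq (c : ℝ) : {x : ℝ | x * x = c}.Finite := by
    refine (Set.toFinite {√c, -√c}).subset ?_
    rintro x rfl
    rw [Real.sqrt_mul_self_eq_abs]
    rcases abs_choice x with h | h <;> simp [h]
  refine ((hsq (-A 1 0 / s)).prod (hsq (A 0 1 / s))).subset ?_
  rintro v rfl
  constructor <;> simp [parabolic] <;> field_simp

section CuspOrbits

variable {Γ : Subgroup SL(2, ℝ)} {K : ℕ} {g : Fin K → SL(2, ℝ)}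

/-- The vectors `(0, 1) g_κ γ`, `γ ∈ Γ`. They form a discrete set which encodes the `κ`-th cusp:
the horocycle flow of `Γ x` enters the cusp whenever `x` moves one of them near the positive
vertical axis. -/
def cuspOrbit (Γ : Subgroup SL(2, ℝ)) (g : Fin K → SL(2, ℝ)) (κ : Fin K) : Set (ℝ × ℝ) :=
  Set.range fun γ : Γ => bottomRow (g κ * γ)

theorem finite_inter_of_isCompact {G : Type*} [Group G] [TopologicalSpace G] [IsTopologicalGroup G]
    [T2Space G] (Λ : Subgroup G) [DiscreteTopology Λ] {C : Set G} (hC : IsCompact C) :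
    ((Λ : Set G) ∩ C).Finite := by
  have hpre : ((↑) ⁻¹' C : Set Λ).Finite := by
    simpa using Λ.tendsto_coe_cofinite_of_discrete
      (isDiscrete_iff_discreteTopology.2 inferInstance) hC.compl_mem_cocompact
  exact (hpre.image ((↑) : Λ → G)).subset fun x hx => ⟨⟨x, hx.1⟩, hx.2, rfl⟩

theorem parabolic_one_mem (hg : IsCuspScaling Γ g) {κ : Fin K} {v : ℝ × ℝ}
    (hv : v ∈ cuspOrbit Γ g κ) : parabolic 1 v ∈ Γ := by
  obtain ⟨γ, rfl⟩ := hv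
  have hmem := Γ.mul_mem (Γ.mul_mem (Γ.inv_mem γ.2)
    ((hg.width_one κ 1).2 ⟨1, Int.cast_one.symm⟩)) γ.2
  simpa only [← inv_mul_stableMatrix_mul, mul_inv_rev, mul_assoc] using hmem

theorem finite_cuspOrbit_inter [DiscreteTopology Γ] (hg : IsCuspScaling Γ g) (κ : Fin K)
    {B : Set (ℝ × ℝ)} (hB : Bornology.IsBounded B) : (cuspOrbit Γ g κ ∩ B).Finite := by
  have hfin := finite_inter_of_isCompact Γ
    (hB.isCompact_closure.image (continuous_parabolic 1))
  refine (hfin.preimage' fun A _ => finite_preimage_parabolic one_ne_zero A).subset ?_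
  exact fun v hv => ⟨parabolic_one_mem hg hv.1, v, subset_closure hv.2, rfl⟩

theorem finite_cuspOrbit_rowAct_mem [DiscreteTopology Γ] (hg : IsCuspScaling Γ g) (κ : Fin K)
    {N : Set SL(2, ℝ)} (hN : IsCompact N) {B : Set (ℝ × ℝ)} (hB : Bornology.IsBounded B) :
    {v ∈ cuspOrbit Γ g κ | ∃ x ∈ N, rowAct x v ∈ B}.Finite := by
  have hback : Continuous fun p : SL(2, ℝ) × (ℝ × ℝ) => rowAct p.1⁻¹ p.2 :=
    continuous_rowAct.comp (continuous_fst.inv.prodMk continuous_snd)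
  refine (finite_cuspOrbit_inter hg κ
    ((hN.prod hB.isCompact_closure).image hback).isBounded).subset ?_
  rintro v ⟨hv, x, hx, hxv⟩
  refine ⟨hv, (x, rowAct x v), ⟨hx, subset_closure hxv⟩, ?_⟩
  simp only [← rowAct_mul, mul_inv_cancel, rowAct_one]

theorem finite_cuspOrbits_rowAct_mem [DiscreteTopology Γ] (hg : IsCuspScaling Γ g) (x : SL(2, ℝ))
    {B : Fin K → Set (ℝ × ℝ)} (hB : ∀ κ, Bornology.IsBounded (B κ)) :
    {p : Fin K × (ℝ × ℝ) | p.2 ∈ cuspOrbit Γ g p.1 ∧ rowAct x p.2 ∈ B p.1}.Finite := by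
  refine (Set.finite_iUnion fun κ => (finite_cuspOrbit_rowAct_mem hg κ
    (isCompact_singleton (x := x)) (hB κ)).image (Prod.mk κ)).subset ?_
  rintro ⟨κ, v⟩ ⟨hv, hB⟩
  exact Set.mem_iUnion.2 ⟨κ, v, ⟨hv, x, rfl, hB⟩, rfl⟩

/-! ### Rigidity of the cusp stabilisers -/

theorem eq_of_lower_left_eq_zero (hg : IsCuspScaling Γ g) {κ ℓ : Fin K} {γ : SL(2, ℝ)}
    (hγ : γ ∈ Γ) (h0 : (g ℓ * γ * (g κ)⁻¹) 1 0 = 0) : κ = ℓ := by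
  by_contra hne
  refine hg.inequivalent κ ℓ hne γ hγ ?_
  have hfix : Matrix.SpecialLinearGroup.toGL (g ℓ * γ * (g κ)⁻¹) •
      (OnePoint.infty : OnePoint ℝ) = OnePoint.infty :=
    OnePoint.smul_infty_eq_self_iff.2 h0
  rw [cuspOf, cuspOf, smul_smul, ← map_mul]
  conv_rhs => rw [← hfix]
  rw [smul_smul, ← map_mul]
  congr 2
  group

theorem exists_int_eq_lower_right_mul_self (hg : IsCuspScaling Γ g) {κ : Fin K} {γ : SL(2, ℝ)}
    (hγ : γ ∈ Γ) (h0 : (g κ * γ * (g κ)⁻¹) 1 0 = 0) :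
    ∃ m : ℤ, (g κ * γ * (g κ)⁻¹) 1 1 * (g κ * γ * (g κ)⁻¹) 1 1 = m := by
  rw [← hg.width_one κ]
  have hconj := inv_mul_stableMatrix_mul (g κ * γ * (g κ)⁻¹) 1
  rw [parabolic_of_fst_eq_zero (v := bottomRow (g κ * γ * (g κ)⁻¹)) h0, one_mul] at hconj
  have hmem := Γ.mul_mem (Γ.mul_mem (Γ.inv_mem hγ)
    ((hg.width_one κ 1).2 ⟨1, Int.cast_one.symm⟩)) hγ
  convert hmem using 1
  refine (congrArg (fun A => (g κ)⁻¹ * A * g κ) hconj).symm.trans ?_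
  group

theorem lower_right_mul_self_eq_one (hg : IsCuspScaling Γ g) {κ : Fin K} {γ : SL(2, ℝ)}
    (hγ : γ ∈ Γ) (h0 : (g κ * γ * (g κ)⁻¹) 1 0 = 0) :
    (g κ * γ * (g κ)⁻¹) 1 1 * (g κ * γ * (g κ)⁻¹) 1 1 = 1 := by
  obtain ⟨-, -, h10, h11⟩ := inv_entries (g κ * γ * (g κ)⁻¹)
  have hinv : (g κ * γ * (g κ)⁻¹)⁻¹ = g κ * γ⁻¹ * (g κ)⁻¹ := by group
  have hdet := det_entries (g κ * γ * (g κ)⁻¹)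
  rw [h0, mul_zero, sub_zero] at hdet
  rw [hinv] at h10 h11
  obtain ⟨m, hm⟩ := exists_int_eq_lower_right_mul_self hg hγ h0
  obtain ⟨n, hn⟩ := exists_int_eq_lower_right_mul_self hg (Γ.inv_mem hγ) (by rw [h10, h0, neg_zero])
  rw [h11] at hn
  have hmn : m * n = 1 := by
    rify
    rw [← hm, ← hn]
    linear_combination ((g κ * γ * (g κ)⁻¹) 0 0 * (g κ * γ * (g κ)⁻¹) 1 1 + 1) * hdet
  have hm0 : 0 ≤ m := by
    rify
    exact hm ▸ mul_self_nonneg _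
  rw [hm, Int.eq_one_of_mul_eq_one_right hm0 hmn, Int.cast_one]

theorem exists_eq_stableMatrix (hg : IsCuspScaling Γ g) {κ : Fin K} {γ : SL(2, ℝ)} (hγ : γ ∈ Γ)
    (h0 : (g κ * γ * (g κ)⁻¹) 1 0 = 0) (hpos : 0 < (g κ * γ * (g κ)⁻¹) 1 1) :
    ∃ m : ℤ, g κ * γ * (g κ)⁻¹ = stableMatrix m := by
  have h11 : (g κ * γ * (g κ)⁻¹) 1 1 = 1 := by
    nlinarith [lower_right_mul_self_eq_one hg hγ h0]
  have hstable : g κ * γ * (g κ)⁻¹ = stableMatrix ((g κ * γ * (g κ)⁻¹) 0 1) :=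
    ext_of_lower_right_ne_zero rfl h0 h11 hpos.ne'
  obtain ⟨m, hm⟩ := (hg.width_one κ ((g κ * γ * (g κ)⁻¹) 0 1)).1 (by
    rw [← hstable]
    convert hγ using 1
    group)
  exact ⟨m, by rw [← hm, ← hstable]⟩

theorem exists_bottomRow_eq_mem_Ico (hg : IsCuspScaling Γ g) (κ : Fin K) (γ : Γ) {x : SL(2, ℝ)}
    (h : (g κ * γ * x) 1 1 ≠ 0) : ∃ γ' : Γ, bottomRow (g κ * γ' * x) = bottomRow (g κ * γ * x) ∧
      (g κ * γ' * x) 0 1 / (g κ * γ' * x) 1 1 ∈ Set.Ico (0 : ℝ) 1 := by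
  set A := g κ * γ * x with hA
  set n := ⌊A 0 1 / A 1 1⌋
  have hmem := (hg.width_one κ (-n : ℝ)).2 ⟨-n, (Int.cast_neg n).symm⟩
  refine ⟨⟨_, Γ.mul_mem hmem γ.2⟩, ?_⟩
  have hB : g κ * ((g κ)⁻¹ * stableMatrix (-n : ℝ) * g κ * γ) * x =
      stableMatrix (-n : ℝ) * A := by rw [hA]; group
  have h10 : (stableMatrix (-n : ℝ) * A) 1 0 = A 1 0 := by simp [mul_entry]
  have h11 : (stableMatrix (-n : ℝ) * A) 1 1 = A 1 1 := by simp [mul_entry]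
  have h01 : (stableMatrix (-n : ℝ) * A) 0 1 / A 1 1 = Int.fract (A 0 1 / A 1 1) := by
    simp only [mul_entry, stableMatrix_zero_zero, stableMatrix_zero_one, Int.fract]
    field_simp
    ring
  simp only [hB, bottomRow, h10, h11, h01, true_and]
  exact ⟨Int.fract_nonneg _, Int.fract_lt_one _⟩

theorem exists_bottomRow_eq_neg (hneg : (-1 : SL(2, ℝ)) ∈ Γ) (κ : Fin K) (γ : Γ) (x : SL(2, ℝ)) :
    ∃ γ' : Γ, bottomRow (g κ * γ' * x) = -bottomRow (g κ * γ * x) :=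
  ⟨⟨-1, hneg⟩ * γ, by simp [bottomRow]⟩

end CuspOrbits

/-! ### Sections and heights in terms of cusp orbits -/

section Sections

variable {Γ : Subgroup SL(2, ℝ)} {K : ℕ} {g : Fin K → SL(2, ℝ)} {R R' : Fin K → Set (ℝ × ℝ)}

theorem mk_eq_mk {x y : SL(2, ℝ)} :
    UnitTangent.mk Γ x = UnitTangent.mk Γ y ↔ ∃ γ : Γ, γ * y = x :=
  Quotient.eq (r := MulAction.orbitRel Γ SL(2, ℝ))

theorem mk_surjective : Function.Surjective (UnitTangent.mk Γ) := Quotient.mk_surjective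

@[simp] theorem rightMul_mk (h x : SL(2, ℝ)) :
    rightMul h (UnitTangent.mk Γ x) = UnitTangent.mk Γ (x * h) := rfl

/-- The set of matrices `x` which move some vector of the orbit of the cusp `κ` into `R κ`, for
some `κ`. -/
def hitSet (Γ : Subgroup SL(2, ℝ)) (g : Fin K → SL(2, ℝ)) (R : Fin K → Set (ℝ × ℝ)) :
    Set SL(2, ℝ) :=
  {x | ∃ κ, ∃ γ : Γ, bottomRow (g κ * γ * x) ∈ R κ}

/-- The projection of `hitSet` to the unit tangent bundle. -/
def hitQuot (Γ : Subgroup SL(2, ℝ)) (g : Fin K → SL(2, ℝ)) (R : Fin K → Set (ℝ × ℝ)) :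
    Set (UnitTangent Γ) :=
  UnitTangent.mk Γ '' hitSet Γ g R

theorem mem_hitSet {x : SL(2, ℝ)} :
    x ∈ hitSet Γ g R ↔ ∃ κ, ∃ γ : Γ, bottomRow (g κ * γ * x) ∈ R κ := Iff.rfl

theorem coe_mul_mem_hitSet (γ : Γ) {x : SL(2, ℝ)} :
    (γ : SL(2, ℝ)) * x ∈ hitSet Γ g R ↔ x ∈ hitSet Γ g R := by
  refine exists_congr fun κ => (Equiv.mulRight γ).exists_congr fun δ => ?_
  simp [mul_assoc]

theorem mk_mem_hitQuot {x : SL(2, ℝ)} :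
    UnitTangent.mk Γ x ∈ hitQuot Γ g R ↔ x ∈ hitSet Γ g R := by
  refine ⟨?_, fun h => ⟨x, h, rfl⟩⟩
  rintro ⟨y, hy, hyx⟩
  obtain ⟨γ, rfl⟩ := mk_eq_mk.1 hyx
  exact (coe_mul_mem_hitSet γ).1 hy

theorem mk_preimage_hitQuot : UnitTangent.mk Γ ⁻¹' hitQuot Γ g R = hitSet Γ g R :=
  Set.ext fun _ => mk_mem_hitQuot

theorem mul_mem_hitSet {x h : SL(2, ℝ)} :
    x * h ∈ hitSet Γ g R ↔ x ∈ hitSet Γ g fun κ => rowAct h ⁻¹' R κ := by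
  simp only [mem_hitSet, Set.mem_preimage, ← bottomRow_mul, mul_assoc]

theorem hitSet_mono (h : ∀ κ, R κ ⊆ R' κ) : hitSet Γ g R ⊆ hitSet Γ g R' :=
  fun _ ⟨κ, γ, hx⟩ => ⟨κ, γ, h κ hx⟩

theorem hitQuot_mono (h : ∀ κ, R κ ⊆ R' κ) : hitQuot Γ g R ⊆ hitQuot Γ g R' :=
  Set.image_mono (hitSet_mono h)

theorem geodesicFlow_stableFlow_basePoint_eq_mk_iff {s t : ℝ} {κ : Fin K} {x : SL(2, ℝ)} :
    geodesicFlow t (stableFlow s (basePoint Γ g κ)) = UnitTangent.mk Γ x ↔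
      ∃ γ : Γ, g κ * γ * x = flowBox s t 0 := by
  rw [basePoint, stableFlow, geodesicFlow, rightMul_mk, rightMul_mk, mk_eq_mk]
  simp only [flowBox_zero_right, mul_assoc, eq_inv_mul_iff_mul_eq]

theorem eq_flowBox_zero {y : SL(2, ℝ)} (h0 : y 1 0 = 0) (hpos : 0 < y 1 1) :
    y = flowBox (y 0 1 / y 1 1) (-(2 * Real.log (y 1 1))) 0 := by
  simpa only [h0, zero_div] using eq_flowBox hpos

theorem le_neg_two_mul_log_iff {a c : ℝ} (ha : 0 < a) :
    c ≤ -(2 * Real.log a) ↔ a ≤ Real.exp (-(c / 2)) := by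
  rw [← Real.log_le_iff_le_exp ha]
  constructor <;> intro h <;> linarith

theorem lt_neg_two_mul_log_iff {a c : ℝ} (ha : 0 < a) :
    c < -(2 * Real.log a) ↔ a < Real.exp (-(c / 2)) := by
  rw [← Real.log_lt_iff_lt_exp ha]
  constructor <;> intro h <;> linarith

theorem mk_mem_multiSection (σ : Fin K → ℝ) (L : ℝ) (x : SL(2, ℝ)) :
    UnitTangent.mk Γ x ∈ multiSection Γ g σ L ↔ x ∈ hitSet Γ g fun κ =>
      {v | v.1 = 0 ∧ 0 < v.2 ∧ v.2 ≤ Real.exp (-((σ κ + L) / 2))} := by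
  simp only [multiSection, cuspSection, closedHorocycle, Set.mem_iUnion, Set.mem_image,
    Set.exists_range_iff, geodesicFlow_stableFlow_basePoint_eq_mk_iff, mem_hitSet, exists_prop]
  refine exists_congr fun κ => ⟨?_, ?_⟩
  · rintro ⟨t, ht, s, γ, hγ⟩
    refine ⟨γ, ?_⟩
    rw [hγ, bottomRow_flowBox, zero_mul]
    exact ⟨rfl, Real.exp_pos _, Real.exp_le_exp.2 (by linarith [Set.mem_Ici.1 ht])⟩
  · rintro ⟨γ, h0, hpos, hle⟩
    exact ⟨_, (le_neg_two_mul_log_iff hpos).2 hle, _, γ, eq_flowBox_zero h0 hpos⟩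

theorem unstableFlow_mk_mem_multiSection (σ : Fin K → ℝ) (r : ℝ) (x : SL(2, ℝ)) :
    unstableFlow r (UnitTangent.mk Γ x) ∈ multiSection Γ g σ 0 ↔ x ∈ hitSet Γ g fun κ =>
      {v | v.1 = r * v.2 ∧ 0 < v.2 ∧ v.2 ≤ Real.exp (-(σ κ / 2))} := by
  rw [unstableFlow, rightMul_mk, mk_mem_multiSection, mul_mem_hitSet]
  simp only [mem_hitSet, Set.mem_ofPred_eq, Set.mem_preimage, rowAct_unstableMatrix, sub_eq_zero,
    add_zero]

theorem lt_relHeight_mk (hg : IsCuspScaling Γ g) (σ : Fin K → ℝ) {h : ℝ} (hh : 0 ≤ h)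
    (x : SL(2, ℝ)) :
    (h : EReal) < relHeight g σ (UnitTangent.mk Γ x) ↔ x ∈ hitSet Γ g fun κ =>
      {v | v.1 = 0 ∧ 0 < v.2 ∧ v.2 < Real.exp (-((σ κ + h) / 2))} := by
  simp only [relHeight, sectionMap, lt_iSup_iff, EReal.coe_lt_coe_iff, Set.mem_ofPred_eq,
    geodesicFlow_stableFlow_basePoint_eq_mk_iff]
  constructor
  · rintro ⟨⟨s, t, κ⟩, ⟨-, γ, hγ⟩, hlt⟩
    refine ⟨κ, γ, ?_⟩
    rw [hγ, bottomRow_flowBox, zero_mul]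
    exact ⟨rfl, Real.exp_pos _, Real.exp_lt_exp.2 (by linarith)⟩
  · rintro ⟨κ, γ, hv⟩
    obtain ⟨γ', hrow, hs⟩ := exists_bottomRow_eq_mem_Ico hg κ γ hv.2.1.ne'
    rw [← hrow] at hv
    obtain ⟨h0, hpos, hlt⟩ := hv
    have hlog := (lt_neg_two_mul_log_iff hpos).2 hlt
    exact ⟨⟨_, _, κ⟩, ⟨⟨hs, le_trans (by linarith) hlog.le⟩, γ', eq_flowBox_zero h0 hpos⟩,
      lt_sub_iff_add_lt'.2 hlog⟩

theorem im_smul_I (x : SL(2, ℝ)) :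
    (x • UpperHalfPlane.I).im = 1 / ((bottomRow x).1 ^ 2 + (bottomRow x).2 ^ 2) := by
  refine (UpperHalfPlane.im_smul_eq_div_normSq (Matrix.SpecialLinearGroup.toGL x)
    UpperHalfPlane.I).trans ?_
  simp [UpperHalfPlane.denom, Complex.normSq_apply, bottomRow]
  ring

theorem smul_I_eq_self {k : SL(2, ℝ)} (hdiag : k 0 0 = k 1 1) (hoff : k 0 1 = -k 1 0) :
    k • UpperHalfPlane.I = UpperHalfPlane.I := by
  refine UpperHalfPlane.ext ((UpperHalfPlane.coe_specialLinearGroup_apply _ _).trans ?_)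
  refine (div_eq_iff (UpperHalfPlane.denom_ne_zero (Matrix.SpecialLinearGroup.toGL k) _)).2 ?_
  simp [hdiag, hoff, UpperHalfPlane.denom]
  linear_combination (-(k 1 0 : ℂ)) * Complex.I_mul_I

theorem exists_rotation {v : ℝ × ℝ} (hv : v ≠ 0) :
    ∃ k : SL(2, ℝ), k • UpperHalfPlane.I = UpperHalfPlane.I ∧
      rowAct k v = (0, √(v.1 ^ 2 + v.2 ^ 2)) := by
  have hpos : 0 < v.1 ^ 2 + v.2 ^ 2 := by
    by_contra! hle
    exact hv (Prod.ext (by simp; nlinarith) (by simp; nlinarith))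
  set ρ := √(v.1 ^ 2 + v.2 ^ 2)
  have hρ : ρ ≠ 0 := (Real.sqrt_pos.2 hpos).ne'
  have hρ2 : ρ ^ 2 = v.1 ^ 2 + v.2 ^ 2 := Real.sq_sqrt hpos.le
  refine ⟨⟨!![v.2 / ρ, v.1 / ρ; -(v.1 / ρ), v.2 / ρ], ?_⟩, smul_I_eq_self ?_ ?_, ?_⟩
  · rw [Matrix.det_fin_two_of]
    field_simp
    linarith
  · simp
  · simp
  · ext <;> simp [rowAct] <;> field_simp
    · ring
    · linarith

theorem exp_neg_eq_sq (c : ℝ) : Real.exp (-c) = Real.exp (-(c / 2)) ^ 2 := by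
  rw [← Real.exp_nat_mul]
  congr 1
  push_cast
  ring

theorem proj_mk_eq_proj_mk {x y : SL(2, ℝ)} :
    proj (UnitTangent.mk Γ y) = proj (UnitTangent.mk Γ x) ↔
      ∃ γ : Γ, ((γ : SL(2, ℝ)) * x) • UpperHalfPlane.I = y • UpperHalfPlane.I := by
  simp only [mul_smul]
  exact Quotient.eq (r := MulAction.orbitRel Γ UpperHalfPlane)

theorem lt_relHeightSurface_mk (hg : IsCuspScaling Γ g) (σ : Fin K → ℝ) {h : ℝ} (hh : 0 ≤ h)
    (x : SL(2, ℝ)) :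
    (h : EReal) < relHeightSurface g σ (proj (UnitTangent.mk Γ x)) ↔ x ∈ hitSet Γ g fun κ =>
      {v | v.1 ^ 2 + v.2 ^ 2 < Real.exp (-(σ κ + h))} := by
  have hexp (κ : Fin K) := exp_neg_eq_sq (σ κ + h)
  simp only [relHeightSurface, lt_iSup_iff, mk_surjective.exists, Set.mem_ofPred_eq,
    lt_relHeight_mk hg σ hh, proj_mk_eq_proj_mk, hexp]
  constructor
  · rintro ⟨y, ⟨-, δ, hδ⟩, κ, γ, h0, hpos, hlt⟩
    have him := congrArg (fun z => (((g κ * (γ : SL(2, ℝ))) • z : UpperHalfPlane)).im) hδ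
    simp only [smul_smul, im_smul_I, one_div, inv_inj] at him
    refine ⟨κ, γ * δ, ?_⟩
    rw [Set.mem_ofPred_eq, Subgroup.coe_mul, ← mul_assoc, mul_assoc (g κ * γ), him, h0]
    simpa using pow_lt_pow_left₀ hlt hpos.le two_ne_zero
  · rintro ⟨κ, γ, hv⟩
    obtain ⟨k, hkI, hk⟩ := exists_rotation (bottomRow_ne_zero (g κ * γ * x))
    set ρ := √((bottomRow (g κ * γ * x)).1 ^ 2 + (bottomRow (g κ * γ * x)).2 ^ 2)
    have hrow : bottomRow (g κ * γ * (x * k)) = (0, ρ) := by rw [← mul_assoc, bottomRow_mul, hk]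
    have hlt : ρ < Real.exp (-((σ κ + h) / 2)) := (Real.sqrt_lt' (Real.exp_pos _)).2 hv
    have hpos : 0 < ρ := (Real.sqrt_nonneg _).lt_of_ne' fun h0 =>
      bottomRow_ne_zero (g κ * γ * (x * k)) (hrow.trans (Prod.ext rfl h0))
    refine ⟨x * k, ⟨(mk_mem_multiSection σ 0 _).2 ⟨κ, γ, ?_⟩, 1, ?_⟩, κ, γ, ?_⟩
    · rw [hrow]
      exact ⟨rfl, hpos, hlt.le.trans (Real.exp_le_exp.2 (by linarith))⟩
    · rw [Subgroup.coe_one, one_mul, mul_smul, hkI]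
    · rw [hrow]
      exact ⟨rfl, hpos, hlt⟩

/-! ### The extreme value events -/

theorem mem_geodesicFlow_image {t : ℝ} {E : Set (UnitTangent Γ)} {x : SL(2, ℝ)} :
    UnitTangent.mk Γ x ∈ geodesicFlow t '' E ↔ UnitTangent.mk Γ (x * geodesicMatrix (-t)) ∈ E := by
  rw [geodesicMatrix_neg]
  refine ⟨?_, fun h => ⟨_, h, by rw [geodesicFlow, rightMul_mk, inv_mul_cancel_right]⟩⟩
  rintro ⟨y, hy, hyx⟩
  obtain ⟨y, rfl⟩ := mk_surjective y
  rwa [← rightMul_mk, ← hyx, geodesicFlow, rightMul_mk, rightMul_mk, mul_inv_cancel_right]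

theorem mk_mem_geodesicFlow_hitQuot {t : ℝ} {x : SL(2, ℝ)} :
    UnitTangent.mk Γ x ∈ geodesicFlow t '' hitQuot Γ g R ↔ x ∈ hitSet Γ g fun κ =>
      {v | (v.1 * Real.exp (-(t / 2)), v.2 * Real.exp (t / 2)) ∈ R κ} := by
  rw [mem_geodesicFlow_image, mk_mem_hitQuot, mul_mem_hitSet]
  simp only [mem_hitSet, Set.mem_ofPred_eq, Set.mem_preimage, rowAct_geodesicMatrix, neg_div,
    neg_neg]

/-- The vectors which correspond to hitting the section `ℋ(σ, 0)`, above height zero, at a time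
in `(0, e^{-H}]`. -/
def extremeRegion (σ : Fin K → ℝ) (H : ℝ) (κ : Fin K) : Set (ℝ × ℝ) :=
  {v | 0 < v.2 ∧ v.2 < Real.exp (-(σ κ / 2)) ∧ 0 < v.1 ∧ v.1 ≤ Real.exp (-H) * v.2}

/-- A closed neighbourhood of `extremeRegion`, large enough to account for the difference between
heights on the section and heights on the surface. -/
def thickRegion (σ : Fin K → ℝ) (H ε : ℝ) (κ : Fin K) : Set (ℝ × ℝ) :=
  {v | 0 ≤ v.2 ∧ v.2 ≤ Real.exp (-(σ κ / 2)) ∧ -ε ≤ v.1 ∧ v.1 ≤ Real.exp (-H) * v.2 + ε}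

theorem exp_add_log_half {H T : ℝ} (hT : 0 < T) :
    T * Real.exp (-((H + Real.log T) / 2)) =
      Real.exp (-H) * Real.exp ((H + Real.log T) / 2) := by
  nth_rw 1 [← Real.exp_log hT]
  rw [← Real.exp_add, ← Real.exp_add]
  congr 1
  ring

theorem exp_neg_half_add (s L : ℝ) :
    Real.exp (-((s + L) / 2)) = Real.exp (-(s / 2)) * Real.exp (-(L / 2)) := by
  rw [← Real.exp_add]
  congr 1
  ring

theorem rescale_mem_extremeRegion_iff (σ : Fin K → ℝ) {H T : ℝ} (hT : 0 < T) (κ : Fin K)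
    (v : ℝ × ℝ) :
    (v.1 * Real.exp (-((H + Real.log T) / 2)), v.2 * Real.exp ((H + Real.log T) / 2)) ∈
      extremeRegion σ H κ ↔
    0 < v.2 ∧ v.2 < Real.exp (-((σ κ + (H + Real.log T)) / 2)) ∧ 0 < v.1 ∧ v.1 ≤ T * v.2 := by
  have hscale := exp_add_log_half (H := H) hT
  have hneg := Real.exp_pos (-((H + Real.log T) / 2))
  refine and_congr (mul_pos_iff_of_pos_right (Real.exp_pos _)) (and_congr ?_
    (and_congr (mul_pos_iff_of_pos_right hneg) ?_))
  · rw [exp_neg_half_add (σ κ), Real.exp_neg ((H + Real.log T) / 2),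
      ← div_eq_mul_inv (Real.exp (-(σ κ / 2))), lt_div_iff₀ (Real.exp_pos _)]
  · rw [← mul_le_mul_iff_left₀ hneg (b := v.1), mul_right_comm T, hscale, mul_assoc, mul_comm v.2]

theorem sectionExtreme_eq (hg : IsCuspScaling Γ g) (σ : Fin K → ℝ) {H T : ℝ} (hT : 0 < T)
    (hHT : 0 ≤ H + Real.log T) :
    {x₀ : UnitTangent Γ | ((H + Real.log T : ℝ) : EReal) <
      ⨆ ξ ∈ hittingTimes g σ 0 x₀ ∩ Set.Icc 0 T, relHeight g σ (unstableFlow ξ x₀)} =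
    geodesicFlow (H + Real.log T) '' hitQuot Γ g (extremeRegion σ H) := by
  ext x₀
  obtain ⟨x, rfl⟩ := mk_surjective x₀
  have hheight (ξ : ℝ) : ((H + Real.log T : ℝ) : EReal) <
      relHeight g σ (unstableFlow ξ (UnitTangent.mk Γ x)) ↔ x ∈ hitSet Γ g fun κ =>
        {v | v.1 = ξ * v.2 ∧ 0 < v.2 ∧ v.2 < Real.exp (-((σ κ + (H + Real.log T)) / 2))} := by
    rw [unstableFlow, rightMul_mk, lt_relHeight_mk hg σ hHT, mul_mem_hitSet]
    simp only [Set.preimage_ofPred_eq, rowAct_unstableMatrix, sub_eq_zero]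
  simp only [mk_mem_geodesicFlow_hitQuot, rescale_mem_extremeRegion_iff σ hT, lt_iSup_iff,
    Set.mem_ofPred_eq, hheight]
  constructor
  · rintro ⟨ξ, ⟨⟨hξ, -⟩, hξT⟩, κ, γ, hv1, hpos, hlt⟩
    refine ⟨κ, γ, hpos, hlt, ?_, ?_⟩
    · exact hv1 ▸ mul_pos hξ hpos
    · exact hv1 ▸ mul_le_mul_of_nonneg_right hξT.2 hpos.le
  · rintro ⟨κ, γ, hpos, hlt, hpos', hle⟩
    have hξ := div_pos hpos' hpos
    have hv1 := (div_mul_cancel₀ (bottomRow (g κ * γ * x)).1 hpos.ne').symm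
    refine ⟨_, ⟨⟨hξ, (unstableFlow_mk_mem_multiSection σ _ x).2 ⟨κ, γ, hv1, hpos, ?_⟩⟩,
      hξ.le, (div_le_iff₀ hpos).2 hle⟩, κ, γ, hv1, hpos, hlt⟩
    exact hlt.le.trans (Real.exp_le_exp.2 (by linarith))

theorem sectionExtreme_subset_surfaceExtreme (σ : Fin K → ℝ) (h T : ℝ) :
    {x₀ : UnitTangent Γ | (h : EReal) <
      ⨆ ξ ∈ hittingTimes g σ 0 x₀ ∩ Set.Icc 0 T, relHeight g σ (unstableFlow ξ x₀)} ⊆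
    {x₀ : UnitTangent Γ | (h : EReal) <
      ⨆ s ∈ Set.Icc 0 T, relHeightSurface g σ (proj (unstableFlow s x₀))} := by
  intro x₀ hx
  rw [Set.mem_ofPred_eq] at hx ⊢
  refine hx.trans_le (iSup₂_le fun ξ hξ => le_iSup₂_of_le ξ hξ.2 ?_)
  exact le_iSup₂_of_le (f := fun x _ => relHeight g σ x) (unstableFlow ξ x₀) ⟨hξ.1.2, rfl⟩ le_rfl

theorem rescale_mem_thickRegion (σ : Fin K → ℝ) {H T ε s : ℝ} (hT : 0 < T) {κ : Fin K}
    (hε : Real.exp (-(σ κ / 2)) * Real.exp (-(H + Real.log T)) ≤ ε) (hs : s ∈ Set.Icc 0 T)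
    {v : ℝ × ℝ} (h0 : 0 ≤ v.2)
    (hv : (v.1 - s * v.2) ^ 2 + v.2 ^ 2 < Real.exp (-(σ κ + (H + Real.log T)))) :
    (v.1 * Real.exp (-((H + Real.log T) / 2)), v.2 * Real.exp ((H + Real.log T) / 2)) ∈
      thickRegion σ H ε κ := by
  have hscale := exp_add_log_half (H := H) hT
  set L := H + Real.log T
  set a := Real.exp (-(L / 2)) with ha
  set b := Real.exp (L / 2) with hb
  set δ := Real.exp (-(σ κ / 2))
  have ha0 : 0 < a := Real.exp_pos _
  have hb0 : 0 < b := Real.exp_pos _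
  have hab : a * b = 1 := by rw [ha, hb, ← Real.exp_add, neg_add_cancel, Real.exp_zero]
  have hδa : 0 ≤ δ * a := mul_nonneg (Real.exp_pos _).le ha0.le
  rw [exp_neg_eq_sq, exp_neg_half_add] at hv
  rw [exp_neg_eq_sq] at hε
  have hx : |v.1 - s * v.2| < δ * a := abs_lt_of_sq_lt_sq (by nlinarith) hδa
  have hy : |v.2| < δ * a := abs_lt_of_sq_lt_sq (by nlinarith) hδa
  rw [abs_lt] at hx hy
  have hsv : 0 ≤ s * v.2 := mul_nonneg hs.1 h0
  have hsT : s * v.2 ≤ T * v.2 := mul_le_mul_of_nonneg_right hs.2 h0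
  refine ⟨mul_nonneg h0 hb0.le, ?_, ?_, ?_⟩
  · calc v.2 * b ≤ δ * a * b := mul_le_mul_of_nonneg_right hy.2.le hb0.le
      _ = δ := by rw [mul_assoc, hab, mul_one]
  · calc -ε ≤ -(δ * a) * a := by linarith
      _ ≤ v.1 * a := mul_le_mul_of_nonneg_right (by linarith) ha0.le
  · calc v.1 * a ≤ (T * v.2 + δ * a) * a := mul_le_mul_of_nonneg_right (by linarith) ha0.le
      _ = Real.exp (-H) * (v.2 * b) + δ * a ^ 2 := by linear_combination v.2 * hscale
      _ ≤ Real.exp (-H) * (v.2 * b) + ε := by linarith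

theorem surfaceExtreme_subset (hneg : (-1 : SL(2, ℝ)) ∈ Γ) (hg : IsCuspScaling Γ g)
    (σ : Fin K → ℝ) {H T ε : ℝ} (hT : 0 < T) (hHT : 0 ≤ H + Real.log T)
    (hε : ∀ κ, Real.exp (-(σ κ / 2)) * Real.exp (-(H + Real.log T)) ≤ ε) :
    {x₀ : UnitTangent Γ | ((H + Real.log T : ℝ) : EReal) <
      ⨆ s ∈ Set.Icc 0 T, relHeightSurface g σ (proj (unstableFlow s x₀))} ⊆
    geodesicFlow (H + Real.log T) '' hitQuot Γ g (thickRegion σ H ε) := by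
  intro x₀ hx
  obtain ⟨x, rfl⟩ := mk_surjective x₀
  simp only [Set.mem_ofPred_eq, lt_iSup_iff] at hx
  obtain ⟨s, hs, hlt⟩ := hx
  rw [unstableFlow, rightMul_mk, lt_relHeightSurface_mk hg σ hHT, mul_mem_hitSet] at hlt
  obtain ⟨κ, γ, hv⟩ := hlt
  rw [Set.mem_preimage, rowAct_unstableMatrix] at hv
  rw [mk_mem_geodesicFlow_hitQuot]
  rcases le_total 0 (bottomRow (g κ * γ * x)).2 with h0 | h0
  · exact ⟨κ, γ, rescale_mem_thickRegion σ hT (hε κ) hs h0 hv⟩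
  · obtain ⟨γ', hγ'⟩ := exists_bottomRow_eq_neg (g := g) hneg κ γ x
    refine ⟨κ, γ', rescale_mem_thickRegion σ hT (hε κ) hs ?_ ?_⟩
    · simpa [hγ'] using h0
    · rw [hγ']
      refine lt_of_eq_of_lt ?_ hv
      simp only [Prod.fst_neg, Prod.snd_neg]
      ring

end Sections

/-! ### Hit sets and the Liouville measure -/

section HitSets

variable {Γ : Subgroup SL(2, ℝ)} {K : ℕ} {g : Fin K → SL(2, ℝ)} {R : Fin K → Set (ℝ × ℝ)}

theorem countable_of_discreteTopology {X : Type*} [TopologicalSpace X]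
    [SecondCountableTopology X] (s : Set X) [DiscreteTopology s] : Countable s :=
  TopologicalSpace.separableSpace_iff_countable.1 inferInstance

theorem quasiMeasurePreserving_bottomRow_mul (a : SL(2, ℝ)) :
    Measure.QuasiMeasurePreserving (fun x => bottomRow (a * x)) Measure.haar volume :=
  quasiMeasurePreserving_bottomRow.comp
    (measurePreserving_mul_left Measure.haar a).quasiMeasurePreserving

theorem hitSet_eq_iUnion :
    hitSet Γ g R = ⋃ κ, ⋃ γ : Γ, (fun x => bottomRow (g κ * γ * x)) ⁻¹' R κ := by
  ext x
  simp [hitSet]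

theorem hitSet_eq_iUnion_cuspOrbit :
    hitSet Γ g R = ⋃ p : Σ κ, cuspOrbit Γ g κ, (fun x => rowAct x p.2) ⁻¹' R p.1 := by
  ext x
  simp [hitSet, cuspOrbit, bottomRow_mul]

theorem measurableSet_hitSet [DiscreteTopology Γ] (hR : ∀ κ, MeasurableSet (R κ)) :
    MeasurableSet (hitSet Γ g R) := by
  have : Countable Γ := countable_of_discreteTopology (Γ : Set SL(2, ℝ))
  rw [hitSet_eq_iUnion]
  exact MeasurableSet.iUnion fun κ => MeasurableSet.iUnion fun γ =>
    (quasiMeasurePreserving_bottomRow_mul _).measurable (hR κ)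

theorem haar_hitSet_null [DiscreteTopology Γ] (hR : ∀ κ, volume (R κ) = 0) :
    (Measure.haar : Measure SL(2, ℝ)) (hitSet Γ g R) = 0 := by
  have : Countable Γ := countable_of_discreteTopology (Γ : Set SL(2, ℝ))
  rw [hitSet_eq_iUnion]
  exact measure_iUnion_null fun κ => measure_iUnion_null fun γ =>
    (quasiMeasurePreserving_bottomRow_mul _).preimage_null (hR κ)

theorem isOpenQuotientMap_mk : IsOpenQuotientMap (UnitTangent.mk Γ) :=
  MulAction.isOpenQuotientMap_quotientMk (Γ := Γ) (T := SL(2, ℝ))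

theorem continuous_rowAct_left (v : ℝ × ℝ) : Continuous fun x : SL(2, ℝ) => rowAct x v :=
  continuous_rowAct.comp (Continuous.prodMk_left v)

theorem closure_hitSet_subset [DiscreteTopology Γ] (hg : IsCuspScaling Γ g)
    (hb : ∀ κ, Bornology.IsBounded (R κ)) :
    closure (hitSet Γ g R) ⊆ hitSet Γ g fun κ => closure (R κ) := by
  have hlf : LocallyFinite fun p : Σ κ, cuspOrbit Γ g κ =>
      (fun x => rowAct x p.2) ⁻¹' R p.1 := by
    intro x
    obtain ⟨N, hN, hxN⟩ := exists_compact_mem_nhds x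
    refine ⟨N, hxN, (Set.finite_iUnion fun κ => ((finite_cuspOrbit_rowAct_mem hg κ hN
      (hb κ)).preimage Subtype.val_injective.injOn).image (Sigma.mk κ)).subset ?_⟩
    rintro ⟨κ, v⟩ ⟨y, hyR, hyN⟩
    exact Set.mem_iUnion.2 ⟨κ, v, ⟨v.2, y, hyN, hyR⟩, rfl⟩
  rw [hitSet_eq_iUnion_cuspOrbit, hlf.closure_iUnion, hitSet_eq_iUnion_cuspOrbit]
  exact Set.iUnion_mono fun p => (continuous_rowAct_left _).closure_preimage_subset _

theorem frontier_hitSet_subset [DiscreteTopology Γ] (hg : IsCuspScaling Γ g)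
    (hb : ∀ κ, Bornology.IsBounded (R κ)) :
    frontier (hitSet Γ g R) ⊆ hitSet Γ g fun κ => frontier (R κ) := by
  intro x hx
  obtain ⟨κ, γ, hκ⟩ := closure_hitSet_subset hg hb hx.1
  refine ⟨κ, γ, hκ, fun hint => hx.2 ?_⟩
  rw [bottomRow_mul] at hint
  refine interior_maximal ?_ (isOpen_interior.preimage
    (continuous_rowAct_left (bottomRow (g κ * γ)))) hint
  intro y hy
  exact ⟨κ, γ, by rw [bottomRow_mul]; exact interior_subset hy⟩

theorem isClosed_hitQuot [DiscreteTopology Γ] (hg : IsCuspScaling Γ g)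
    (hb : ∀ κ, Bornology.IsBounded (R κ)) (hR : ∀ κ, IsClosed (R κ)) :
    IsClosed (hitQuot Γ g R) := by
  rw [← isOpenQuotientMap_mk.isQuotientMap.isClosed_preimage, mk_preimage_hitQuot]
  refine isClosed_of_closure_subset ((closure_hitSet_subset hg hb).trans ?_)
  simp only [fun κ => (hR κ).closure_eq, subset_rfl]

theorem measurableSet_hitQuot [DiscreteTopology Γ] (hg : IsCuspScaling Γ g)
    {U : Fin K → Set (ℝ × ℝ)} (hb : ∀ κ, Bornology.IsBounded (U κ ∩ R κ))
    (hU : ∀ κ, IsOpen (U κ)) (hR : ∀ κ, IsClosed (R κ)) :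
    MeasurableSet (hitQuot Γ g fun κ => U κ ∩ R κ) := by
  choose A hAc hAU hA _ using fun κ => (hU κ).exists_iUnion_isClosed
  have hunion : hitQuot Γ g (fun κ => U κ ∩ R κ) =
      ⋃ n, hitQuot Γ g (fun κ => A κ n ∩ R κ) := by
    refine Set.Subset.antisymm ?_
      (Set.iUnion_subset fun n => hitQuot_mono fun κ => Set.inter_subset_inter_left _ (hAU κ n))
    rintro _ ⟨x, ⟨κ, γ, hx⟩, rfl⟩
    beta_reduce at hx
    rw [← hA κ] at hx
    obtain ⟨n, hn⟩ := Set.mem_iUnion.1 hx.1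
    exact Set.mem_iUnion.2 ⟨n, x, ⟨κ, γ, hn, hx.2⟩, rfl⟩
  rw [hunion]
  exact MeasurableSet.iUnion fun n => (isClosed_hitQuot hg
    (fun κ => (hb κ).subset (Set.inter_subset_inter_left _ (hAU κ n)))
    fun κ => (hAc κ n).inter (hR κ)).measurableSet

theorem liouville_apply {F : Set SL(2, ℝ)} {E : Set (UnitTangent Γ)} (hE : MeasurableSet E) :
    liouville Γ F E = (Measure.haar F)⁻¹ * Measure.haar (UnitTangent.mk Γ ⁻¹' E ∩ F) := by
  have hm : Measurable (UnitTangent.mk Γ) := isOpenQuotientMap_mk.continuous.measurable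
  rw [liouville, Measure.smul_apply, smul_eq_mul, Measure.map_apply hm hE,
    Measure.restrict_apply (hm hE)]

theorem liouville_frontier_hitQuot [DiscreteTopology Γ] (hg : IsCuspScaling Γ g)
    (F : Set SL(2, ℝ)) (hb : ∀ κ, Bornology.IsBounded (R κ))
    (h0 : ∀ κ, volume (frontier (R κ)) = 0) :
    liouville Γ F (frontier (hitQuot Γ g R)) = 0 := by
  rw [liouville_apply isClosed_frontier.measurableSet,
    isOpenQuotientMap_mk.isOpenMap.preimage_frontier_eq_frontier_preimage
      isOpenQuotientMap_mk.continuous, mk_preimage_hitQuot,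
    measure_mono_null (Set.inter_subset_left.trans (frontier_hitSet_subset hg hb))
      (haar_hitSet_null h0), mul_zero]

theorem measure_preimage_mul_right_inter {G : Type*} [Group G] [MeasurableSpace G]
    [MeasurableMul₂ G] {Λ : Subgroup G} [Countable Λ] {μ : Measure G} [μ.IsMulLeftInvariant]
    [μ.IsMulRightInvariant] {F : Set G} (hF : IsFundamentalDomain Λ F μ) {A : Set G}
    (hA : MeasurableSet A) (hinv : ∀ (γ : Λ) (x : G), (γ : G) * x ∈ A ↔ x ∈ A) (h : G) :
    μ ((fun x => x * h) ⁻¹' A ∩ F) = μ (A ∩ F) := by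
  have hF' : IsFundamentalDomain Λ ((fun x => x * h⁻¹) ⁻¹' F) μ :=
    hF.preimage_of_equiv (measurePreserving_mul_right _ h⁻¹).quasiMeasurePreserving
      (e := id) Function.bijective_id fun γ x => by simp [Subgroup.smul_def, mul_assoc]
  have hset : (fun x => x * h) ⁻¹' A ∩ F =
      (fun x => x * h) ⁻¹' (A ∩ (fun x => x * h⁻¹) ⁻¹' F) := by
    ext x
    simp
  rw [hset, measure_preimage_mul_right]
  exact hF'.measure_set_eq hF hA fun γ => Set.ext fun x => hinv γ x

/-! ### Almost every orbit hits the section -/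

/-- The vectors which correspond to hitting the section in the direction `ε = ±1` of time. -/
def quadrantStrip (σ : Fin K → ℝ) (ε : ℝ) (κ : Fin K) : Set (ℝ × ℝ) :=
  {v | 0 < v.2 ∧ v.2 ≤ Real.exp (-(σ κ / 2)) ∧ 0 < ε * v.1}

/-- Images of `quadrantStrip` under fixed elements of `SL(2, ℝ)`, which increase with `j` and
exhaust the upper half-plane. -/
def growingStrip (σ : Fin K → ℝ) (ε : ℝ) (j : ℕ) (κ : Fin K) : Set (ℝ × ℝ) :=
  {v | 0 < v.2 ∧ v.2 ≤ Real.exp (-(σ κ / 2)) * Real.exp j ∧ 0 < ε * v.1 + j * v.2}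

theorem growingStrip_mono (σ : Fin K → ℝ) (ε : ℝ) (κ : Fin K) :
    Monotone fun j => growingStrip σ ε j κ := by
  intro i j hij v hv
  have hij' : (i : ℝ) ≤ j := by exact_mod_cast hij
  refine ⟨hv.1, hv.2.1.trans ?_, hv.2.2.trans_le ?_⟩
  · gcongr
  · have := hv.1.le
    gcongr

theorem growingStrip_eq_preimage (σ : Fin K → ℝ) {ε : ℝ} (hε : ε * ε = 1) (j : ℕ) (κ : Fin K) :
    growingStrip σ ε j κ =
      rowAct (unstableMatrix (-(ε * j)) * geodesicMatrix (2 * j)) ⁻¹' quadrantStrip σ ε κ := by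
  ext v
  have hfst : ε * (v.1 - -(ε * j) * v.2) = ε * v.1 + j * v.2 := by
    linear_combination (j : ℝ) * v.2 * hε
  simp only [Set.mem_preimage, rowAct_mul, rowAct_unstableMatrix, rowAct_geodesicMatrix,
    growingStrip, quadrantStrip, Set.mem_ofPred_eq, mul_div_cancel_left₀ _ (two_ne_zero' ℝ)]
  refine and_congr (mul_pos_iff_of_pos_right (Real.exp_pos _)).symm (and_congr ?_ ?_)
  · rw [Real.exp_neg (j : ℝ), ← div_eq_mul_inv, div_le_iff₀ (Real.exp_pos _)]
  · rw [← mul_assoc, mul_pos_iff_of_pos_right (Real.exp_pos _), hfst]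

theorem measurableSet_quadrantStrip (σ : Fin K → ℝ) (ε : ℝ) (κ : Fin K) :
    MeasurableSet (quadrantStrip σ ε κ) :=
  (measurableSet_lt measurable_const measurable_snd).inter
    ((measurableSet_le measurable_snd measurable_const).inter
      (measurableSet_lt measurable_const (measurable_fst.const_mul ε)))

theorem exists_mem_growingStrip (σ : Fin K → ℝ) (ε : ℝ) (κ : Fin K) {v : ℝ × ℝ} (hv : 0 < v.2) :
    ∃ j : ℕ, v ∈ growingStrip σ ε j κ := by
  have hδ := Real.exp_pos (-(σ κ / 2))
  obtain ⟨j, hj⟩ := exists_nat_gt (max (v.2 / Real.exp (-(σ κ / 2))) (-(ε * v.1) / v.2))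
  rw [max_lt_iff, div_lt_iff₀ hδ, div_lt_iff₀ hv] at hj
  have hj_exp : (j : ℝ) ≤ Real.exp j := by linarith [Real.add_one_le_exp (j : ℝ)]
  exact ⟨j, hv, by nlinarith [hj.1], by linarith [hj.2]⟩

theorem exists_mem_hitSet_growingStrip (hneg : (-1 : SL(2, ℝ)) ∈ Γ) (σ : Fin K → ℝ) (ε : ℝ)
    {κ : Fin K} {x : SL(2, ℝ)} (hx : (bottomRow (g κ * x)).2 ≠ 0) :
    ∃ j, x ∈ hitSet Γ g (growingStrip σ ε j) := by
  obtain ⟨γ, hγ⟩ : ∃ γ : Γ, 0 < (bottomRow (g κ * γ * x)).2 := by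
    rcases hx.lt_or_gt with h | h
    · obtain ⟨γ, hγ⟩ := exists_bottomRow_eq_neg (g := g) hneg κ 1 x
      exact ⟨γ, by simpa [hγ] using h⟩
    · exact ⟨1, by simpa using h⟩
  obtain ⟨j, hj⟩ := exists_mem_growingStrip σ ε κ hγ
  exact ⟨j, κ, γ, hj⟩

theorem haar_compl_hitSet_growingStrip_inter [DiscreteTopology Γ] {F : Set SL(2, ℝ)}
    (hF : IsFundamentalDomain Γ F Measure.haar) (g : Fin K → SL(2, ℝ)) (σ : Fin K → ℝ) {ε : ℝ}
    (hε : ε * ε = 1) (j : ℕ) :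
    (Measure.haar : Measure SL(2, ℝ)) ((hitSet Γ g (growingStrip σ ε j))ᶜ ∩ F) =
      Measure.haar ((hitSet Γ g (quadrantStrip σ ε))ᶜ ∩ F) := by
  have : Countable Γ := countable_of_discreteTopology (Γ : Set SL(2, ℝ))
  rw [← measure_preimage_mul_right_inter hF
    (measurableSet_hitSet (measurableSet_quadrantStrip σ ε)).compl
    (fun γ x => not_congr (coe_mul_mem_hitSet γ))
    (unstableMatrix (-(ε * j)) * geodesicMatrix (2 * j))]
  congr 2
  ext x
  rw [Set.mem_preimage, Set.mem_compl_iff, Set.mem_compl_iff, mul_mem_hitSet,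
    ← funext fun κ => growingStrip_eq_preimage σ hε j κ]

-- The sets `(hitSet Γ g (growingStrip σ ε j))ᶜ ∩ F` decrease to a null set, but all have the
-- same measure because they are translates of each other modulo `Γ`.
theorem ae_mem_hitSet_quadrantStrip [DiscreteTopology Γ] (hneg : (-1 : SL(2, ℝ)) ∈ Γ)
    {F : Set SL(2, ℝ)} (hF : IsFundamentalDomain Γ F Measure.haar)
    (hFfin : Measure.haar F ≠ ∞) (κ : Fin K) (g : Fin K → SL(2, ℝ)) (σ : Fin K → ℝ)
    {ε : ℝ} (hε : ε * ε = 1) :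
    ∀ᵐ x ∂(Measure.haar : Measure SL(2, ℝ)), x ∈ hitSet Γ g (quadrantStrip σ ε) := by
  have : Countable Γ := countable_of_discreteTopology (Γ : Set SL(2, ℝ))
  have hmeas (j : ℕ) : MeasurableSet (hitSet Γ g (growingStrip σ ε j))ᶜ := by
    refine (measurableSet_hitSet fun κ => ?_).compl
    rw [growingStrip_eq_preimage σ hε]
    exact (measurePreserving_rowAct _).measurable (measurableSet_quadrantStrip σ ε κ)
  have hlim : Tendsto
      (fun j => (Measure.haar : Measure SL(2, ℝ)) ((hitSet Γ g (growingStrip σ ε j))ᶜ ∩ F)) atTop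
      (𝓝 (Measure.haar (⋂ j, (hitSet Γ g (growingStrip σ ε j))ᶜ ∩ F))) := by
    refine tendsto_measure_iInter_atTop
      (fun j => (hmeas j).nullMeasurableSet.inter hF.nullMeasurableSet) (fun i j hij => ?_)
      ⟨0, ne_top_of_le_ne_top hFfin (measure_mono Set.inter_subset_right)⟩
    exact Set.inter_subset_inter_left _
      (Set.compl_subset_compl.2 (hitSet_mono fun κ => growingStrip_mono σ ε κ hij))
  have hzero : (Measure.haar : Measure SL(2, ℝ))
      (⋂ j, (hitSet Γ g (growingStrip σ ε j))ᶜ ∩ F) = 0 := by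
    refine measure_mono_null (fun x hx => ?_)
      ((quasiMeasurePreserving_bottomRow_mul (g κ)).preimage_null (ae_iff.1 ae_snd_ne_zero))
    by_contra hne
    obtain ⟨j, hj⟩ := exists_mem_hitSet_growingStrip hneg σ ε (not_not.1 hne)
    exact (Set.mem_iInter.1 hx j).1 hj
  simp only [hzero, haar_compl_hitSet_growingStrip_inter hF g σ hε] at hlim
  rw [ae_iff]
  refine hF.measure_zero_of_invariant _ (fun γ => ?_)
    (tendsto_nhds_unique tendsto_const_nhds hlim)
  ext x
  rw [Set.mem_smul_set_iff_inv_smul_mem]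
  exact not_congr (coe_mul_mem_hitSet γ⁻¹)

end HitSets

/-! ### First hitting times -/

section HittingTimes

variable {Γ : Subgroup SL(2, ℝ)} {K : ℕ} {g : Fin K → SL(2, ℝ)} {σ : Fin K → ℝ} {ε : ℝ}

/-- The first hitting time of the section from `Γ x` in the direction `ε = ±1` of time, expressed
through the cusp orbits (`∞` if the section is not hit). -/
def firstHit (Γ : Subgroup SL(2, ℝ)) (g : Fin K → SL(2, ℝ)) (σ : Fin K → ℝ) (ε : ℝ)
    (x : SL(2, ℝ)) : ℝ≥0∞ :=
  ⨅ κ, ⨅ γ : Γ, ⨅ _ : bottomRow (g κ * γ * x) ∈ quadrantStrip σ ε κ,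
    ENNReal.ofReal (ε * (bottomRow (g κ * γ * x)).1 / (bottomRow (g κ * γ * x)).2)

theorem le_firstHit_iff {x : SL(2, ℝ)} {a : ℝ≥0∞} :
    a ≤ firstHit Γ g σ ε x ↔ ∀ κ, ∀ γ : Γ, bottomRow (g κ * γ * x) ∈ quadrantStrip σ ε κ →
      a ≤ ENNReal.ofReal (ε * (bottomRow (g κ * γ * x)).1 / (bottomRow (g κ * γ * x)).2) := by
  simp only [firstHit, le_iInf_iff]

theorem firstHit_le {x : SL(2, ℝ)} {κ : Fin K} {γ : Γ}
    (h : bottomRow (g κ * γ * x) ∈ quadrantStrip σ ε κ) : firstHit Γ g σ ε x ≤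
      ENNReal.ofReal (ε * (bottomRow (g κ * γ * x)).1 / (bottomRow (g κ * γ * x)).2) :=
  le_firstHit_iff.1 le_rfl κ γ h

theorem measurable_firstHit [DiscreteTopology Γ] : Measurable (firstHit Γ g σ ε) := by
  classical
  have : Countable Γ := countable_of_discreteTopology (Γ : Set SL(2, ℝ))
  refine Measurable.iInf fun κ => Measurable.iInf fun γ => ?_
  have hrow := (quasiMeasurePreserving_bottomRow_mul (g κ * γ)).measurable
  simp only [iInf_eq_if]
  exact Measurable.ite (hrow (measurableSet_quadrantStrip σ ε κ))
    (((measurable_fst.comp hrow).const_mul ε).div (measurable_snd.comp hrow)).ennreal_ofReal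
    measurable_const

theorem firstHit_coe_mul (γ : Γ) (x : SL(2, ℝ)) :
    firstHit Γ g σ ε (γ * x) = firstHit Γ g σ ε x := by
  refine iInf_congr fun κ => (Equiv.mulRight γ).iInf_congr fun δ => ?_
  simp [mul_assoc]

theorem iInf_hitting_eq_firstHit (hε : ε * ε = 1) (x : SL(2, ℝ)) :
    ⨅ r ∈ {r : ℝ | 0 < r ∧ unstableFlow (ε * r) (UnitTangent.mk Γ x) ∈ multiSection Γ g σ 0},
      ENNReal.ofReal r = firstHit Γ g σ ε x := by
  refine eq_of_forall_le_iff fun a => ?_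
  simp only [le_firstHit_iff, le_iInf_iff, Set.mem_ofPred_eq, unstableFlow_mk_mem_multiSection]
  constructor
  · intro h κ γ hv
    refine h _ ⟨div_pos hv.2.2 hv.1, κ, γ, ?_, hv.1, hv.2.1⟩
    have := hv.1.ne'
    field_simp
    linear_combination -(bottomRow (g κ * γ * x)).1 * hε
  · rintro h r ⟨hr, κ, γ, h1, h2, h3⟩
    have he : ε * (bottomRow (g κ * γ * x)).1 = r * (bottomRow (g κ * γ * x)).2 := by
      rw [h1]
      linear_combination r * (bottomRow (g κ * γ * x)).2 * hε
    have := h κ γ ⟨h2, h3, by rw [he]; exact mul_pos hr h2⟩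
    rwa [he, mul_div_cancel_right₀ _ h2.ne'] at this

theorem sectionMap_eq_mk (w : ℝ × ℝ × Fin K) :
    sectionMap Γ g w = UnitTangent.mk Γ ((g w.2.2)⁻¹ * flowBox w.1 w.2.1 0) :=
  geodesicFlow_stableFlow_basePoint_eq_mk_iff.2 ⟨1, by simp⟩

theorem returnTime_eq_firstHit (w : ℝ × ℝ × Fin K) :
    returnTime Γ g σ w = firstHit Γ g σ 1 ((g w.2.2)⁻¹ * flowBox w.1 w.2.1 0) := by
  simp only [returnTime, hittingTimes, sectionMap_eq_mk,
    ← iInf_hitting_eq_firstHit (one_mul (1 : ℝ)), one_mul]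

theorem backwardReturnTime_eq_firstHit (w : ℝ × ℝ × Fin K) :
    backwardReturnTime Γ g σ w = firstHit Γ g σ (-1) ((g w.2.2)⁻¹ * flowBox w.1 w.2.1 0) := by
  simp only [backwardReturnTime, sectionMap_eq_mk,
    ← iInf_hitting_eq_firstHit (neg_one_mul (-1 : ℝ) |>.trans (neg_neg 1)), neg_one_mul]

theorem isBounded_quadrantStrip_le (σ : Fin K → ℝ) (hε : ε * ε = 1) (κ : Fin K) (r : ℝ) :
    Bornology.IsBounded {v ∈ quadrantStrip σ ε κ | ε * v.1 / v.2 ≤ r} := by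
  set δ := Real.exp (-(σ κ / 2))
  refine (Metric.isBounded_Icc ((-(|r| * δ), 0) : ℝ × ℝ) (|r| * δ, δ)).subset ?_
  rintro v ⟨⟨h1, h2, h3⟩, h4⟩
  have habs : |v.1| ≤ |r| * δ :=
    calc |v.1| = |ε * v.1| := by
          rcases mul_self_eq_one_iff.1 hε with rfl | rfl <;> simp
      _ = ε * v.1 := abs_of_pos h3
      _ ≤ r * v.2 := (div_le_iff₀ h1).1 h4
      _ ≤ |r| * δ := mul_le_mul (le_abs_self r) h2 h1.le (abs_nonneg r)
  exact ⟨⟨(abs_le.1 habs).1, h1.le⟩, (abs_le.1 habs).2, h2⟩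

theorem exists_eq_firstHit [DiscreteTopology Γ] (hg : IsCuspScaling Γ g) (hε : ε * ε = 1)
    {x : SL(2, ℝ)} (hx : x ∈ hitSet Γ g (quadrantStrip σ ε)) :
    ∃ κ, ∃ γ : Γ, bottomRow (g κ * γ * x) ∈ quadrantStrip σ ε κ ∧
      ENNReal.ofReal (ε * (bottomRow (g κ * γ * x)).1 / (bottomRow (g κ * γ * x)).2) =
        firstHit Γ g σ ε x := by
  obtain ⟨κ₀, γ₀, h₀⟩ := hx
  set time : Fin K × (ℝ × ℝ) → ℝ := fun p => ε * (rowAct x p.2).1 / (rowAct x p.2).2 with htime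
  set earlier : Set (Fin K × (ℝ × ℝ)) := {p | p.2 ∈ cuspOrbit Γ g p.1 ∧
    rowAct x p.2 ∈ quadrantStrip σ ε p.1 ∧ time p ≤ time ⟨κ₀, bottomRow (g κ₀ * γ₀)⟩}
  have hfin : earlier.Finite := finite_cuspOrbits_rowAct_mem hg x fun κ =>
    isBounded_quadrantStrip_le σ hε κ (time ⟨κ₀, bottomRow (g κ₀ * γ₀)⟩)
  rw [bottomRow_mul] at h₀
  obtain ⟨⟨κ, v⟩, ⟨⟨γ, hγ⟩, hstrip, hle⟩, hmin⟩ := Set.exists_min_image earlier time hfin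
    ⟨⟨κ₀, bottomRow (g κ₀ * γ₀)⟩, ⟨γ₀, rfl⟩, h₀, le_rfl⟩
  obtain rfl : bottomRow (g κ * γ) = v := hγ
  simp only [htime, ← bottomRow_mul] at hstrip hle hmin
  refine ⟨κ, γ, hstrip, le_antisymm (le_firstHit_iff.2 fun κ' γ' hv' =>
    ENNReal.ofReal_le_ofReal ?_) (firstHit_le hstrip)⟩
  by_contra! hlt
  have hmem : (κ', bottomRow (g κ' * γ')) ∈ earlier := by
    refine ⟨⟨γ', rfl⟩, ?_, ?_⟩
    · simpa only [← bottomRow_mul] using hv'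
    · simpa only [htime, ← bottomRow_mul] using hlt.le.trans hle
  have := hmin _ hmem
  simp only [← bottomRow_mul] at this
  exact hlt.not_ge this

theorem bottomRow_mul_unstableMatrix_neg (z : SL(2, ℝ)) (r : ℝ) :
    bottomRow (z * unstableMatrix (-r)) =
      ((bottomRow z).1 + r * (bottomRow z).2, (bottomRow z).2) := by
  rw [bottomRow_mul, rowAct_unstableMatrix, neg_mul, sub_neg_eq_add]

theorem firstHit_mul_unstableMatrix_le (hε : ε * ε = 1) {z : SL(2, ℝ)} {r : ℝ} (hr : 0 < r)
    {κ : Fin K} (h0 : (bottomRow (g κ * z)).1 = 0) (hpos : 0 < (bottomRow (g κ * z)).2)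
    (hle : (bottomRow (g κ * z)).2 ≤ Real.exp (-(σ κ / 2))) :
    firstHit Γ g σ ε (z * unstableMatrix (-(ε * r))) ≤ ENNReal.ofReal r := by
  have hrow : bottomRow (g κ * (1 : Γ) * (z * unstableMatrix (-(ε * r)))) =
      (ε * r * (bottomRow (g κ * z)).2, (bottomRow (g κ * z)).2) := by
    rw [Subgroup.coe_one, mul_one, ← mul_assoc, bottomRow_mul_unstableMatrix_neg, h0, zero_add]
  have hfst : ε * (ε * r * (bottomRow (g κ * z)).2) = r * (bottomRow (g κ * z)).2 := by
    linear_combination r * (bottomRow (g κ * z)).2 * hε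
  have hmem : bottomRow (g κ * (1 : Γ) * (z * unstableMatrix (-(ε * r)))) ∈
      quadrantStrip σ ε κ := by
    rw [hrow]
    exact ⟨hpos, hle, hfst ▸ mul_pos hr hpos⟩
  refine (firstHit_le hmem).trans_eq ?_
  rw [hrow, hfst, mul_div_cancel_right₀ _ hpos.ne']

theorem ofReal_le_firstHit_mul_unstableMatrix_iff (hε : ε * ε = 1) (z : SL(2, ℝ)) {r : ℝ}
    (hr : 0 < r) :
    ENNReal.ofReal r ≤ firstHit Γ g σ ε (z * unstableMatrix (-(ε * r))) ↔
      ENNReal.ofReal r ≤ firstHit Γ g σ (-ε) z := by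
  have hfst (v : ℝ × ℝ) : ε * (v.1 + ε * r * v.2) = ε * v.1 + r * v.2 := by
    linear_combination r * v.2 * hε
  simp only [le_firstHit_iff, ← mul_assoc, bottomRow_mul_unstableMatrix_neg]
  refine forall_congr' fun κ => forall_congr' fun γ => ?_
  set v := bottomRow (g κ * γ * z)
  simp only [quadrantStrip, Set.mem_ofPred_eq, hfst, and_imp]
  refine forall_congr' fun h2 => imp_congr_right fun _ => ?_
  have h1 : 0 < ε * v.1 + r * v.2 → (ENNReal.ofReal r ≤
      ENNReal.ofReal ((ε * v.1 + r * v.2) / v.2) ↔ 0 ≤ ε * v.1) := fun h => by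
    rw [ENNReal.ofReal_le_ofReal_iff (div_pos h h2).le, le_div_iff₀ h2, le_add_iff_nonneg_left]
  have h3 : 0 < -ε * v.1 → (ENNReal.ofReal r ≤ ENNReal.ofReal (-ε * v.1 / v.2) ↔
      r * v.2 ≤ -ε * v.1) := fun h => by
    rw [ENNReal.ofReal_le_ofReal_iff (div_pos h h2).le, le_div_iff₀ h2]
  rw [forall_congr' h1, forall_congr' h3, neg_mul]
  have hrv : 0 < r * v.2 := mul_pos hr h2
  constructor <;> intro h h' <;> by_contra! hcon
  · linarith [h (by linarith [hrv])]
  · linarith [h (by linarith [hrv])]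

end HittingTimes

/-! ### A fundamental domain made of flow boxes -/

section HitDomain

variable {Γ : Subgroup SL(2, ℝ)} {K : ℕ} {g : Fin K → SL(2, ℝ)} {σ : Fin K → ℝ} {ε : ℝ}

/-- The points whose first hit, in the direction `ε = ±1` of time, is at the cusp `κ`, where `x`
itself (rather than some `γ x`) leads to the hit, at a point of the section with first coordinate
in `[0, 1)`. -/
def hitDomain (Γ : Subgroup SL(2, ℝ)) (g : Fin K → SL(2, ℝ)) (σ : Fin K → ℝ) (ε : ℝ)
    (κ : Fin K) : Set SL(2, ℝ) :=
  {x | bottomRow (g κ * x) ∈ quadrantStrip σ ε κ ∧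
    (g κ * x) 0 1 / (g κ * x) 1 1 ∈ Set.Ico (0 : ℝ) 1 ∧
    ENNReal.ofReal (ε * (bottomRow (g κ * x)).1 / (bottomRow (g κ * x)).2) = firstHit Γ g σ ε x}

theorem measurableSet_hitDomain [DiscreteTopology Γ] (κ : Fin K) :
    MeasurableSet (hitDomain Γ g σ ε κ) := by
  have hrow := (quasiMeasurePreserving_bottomRow_mul (g κ)).measurable
  have hentry (i j : Fin 2) : Measurable fun x : SL(2, ℝ) => (g κ * x) i j :=
    (measurable_entry i j).comp (measurable_const_mul (g κ))
  exact (hrow (measurableSet_quadrantStrip σ ε κ)).inter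
    ((((hentry 0 1).div (hentry 1 1)) measurableSet_Ico).inter (measurableSet_eq_fun
      (((measurable_fst.comp hrow).const_mul ε).div (measurable_snd.comp hrow)).ennreal_ofReal
      measurable_firstHit))

theorem lower_right_pos_of_mem_hitDomain {κ : Fin K} {x : SL(2, ℝ)}
    (hx : x ∈ hitDomain Γ g σ ε κ) : 0 < (g κ * x) 1 1 :=
  hx.1.1

theorem flowBox_mem_hitDomain_iff (hε : ε * ε = 1) (κ : Fin K) (s t r : ℝ) :
    (g κ)⁻¹ * flowBox s t (ε * r) ∈ hitDomain Γ g σ ε κ ↔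
      s ∈ Set.Ico (0 : ℝ) 1 ∧ t ∈ Set.Ici (σ κ) ∧ 0 < r ∧
        ENNReal.ofReal r = firstHit Γ g σ ε ((g κ)⁻¹ * flowBox s t (ε * r)) := by
  have hexp := Real.exp_pos (-(t / 2))
  have hfst : ε * (ε * r * Real.exp (-(t / 2))) = r * Real.exp (-(t / 2)) := by
    linear_combination r * Real.exp (-(t / 2)) * hε
  have hle : -(t / 2) ≤ -(σ κ / 2) ↔ σ κ ≤ t := by
    constructor <;> intro h <;> linarith
  simp only [hitDomain, Set.mem_ofPred_eq, mul_inv_cancel_left, bottomRow_flowBox, flowBox_zero_one,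
    flowBox_one_one, quadrantStrip, hfst, mul_div_cancel_right₀ _ hexp.ne', hexp, true_and,
    Real.exp_le_exp, mul_pos_iff_of_pos_right hexp, hle, Set.mem_Ici]
  tauto

theorem ofReal_eq_firstHit_flowBox_iff (hε : ε * ε = 1) {κ : Fin K} {t r : ℝ} (s : ℝ)
    (ht : σ κ ≤ t) (hr : 0 < r) :
    ENNReal.ofReal r = firstHit Γ g σ ε ((g κ)⁻¹ * flowBox s t (ε * r)) ↔
      ENNReal.ofReal r ≤ firstHit Γ g σ (-ε) ((g κ)⁻¹ * flowBox s t 0) := by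
  have hrow : bottomRow (g κ * ((g κ)⁻¹ * flowBox s t 0)) = (0, Real.exp (-(t / 2))) := by
    rw [mul_inv_cancel_left, bottomRow_flowBox, zero_mul]
  rw [flowBox_eq_mul s t (ε * r), ← mul_assoc,
    ← ofReal_le_firstHit_mul_unstableMatrix_iff hε _ hr]
  refine (LE.le.ge_iff_eq' (firstHit_mul_unstableMatrix_le hε hr (κ := κ) ?_ ?_ ?_)).symm <;>
    rw [hrow]
  · exact Real.exp_pos _
  · exact Real.exp_le_exp.2 (by linarith)

theorem exists_eq_flowBox_of_mem_hitDomain (hε : ε * ε = 1) {κ : Fin K} {x : SL(2, ℝ)}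
    (hx : x ∈ hitDomain Γ g σ ε κ) : ∃ s t r : ℝ, s ∈ Set.Ico (0 : ℝ) 1 ∧ 0 < r ∧
      ENNReal.ofReal r = firstHit Γ g σ ε x ∧ g κ * x = flowBox s t (ε * r) := by
  have hflow := eq_flowBox (lower_right_pos_of_mem_hitDomain hx)
  have hr : (g κ * x) 1 0 / (g κ * x) 1 1 = ε * (ε * ((g κ * x) 1 0 / (g κ * x) 1 1)) := by
    rw [← mul_assoc, hε, one_mul]
  replace hflow := hflow.trans (congrArg (flowBox _ _) hr)
  have hxeq := eq_inv_mul_of_mul_eq hflow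
  have hx' := hx
  rw [hxeq, flowBox_mem_hitDomain_iff hε, ← hxeq] at hx'
  exact ⟨_, _, _, hx'.1, hx'.2.2.1, hx'.2.2.2, hflow⟩

theorem stableMatrix_mul_flowBox (a s t r : ℝ) :
    stableMatrix a * flowBox s t r = flowBox (a + s) t r := by
  have h : stableMatrix a * stableMatrix s = stableMatrix (a + s) :=
    ext_entries (by simp [mul_entry]) (by simp [mul_entry, add_comm]) (by simp [mul_entry])
      (by simp [mul_entry])
  rw [flowBox, flowBox, ← mul_assoc, ← mul_assoc, h]

theorem flowBox_left_injective {s s' t t' r r' : ℝ} (h : flowBox s t r = flowBox s' t' r') :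
    s = s' := by
  have h11 : Real.exp (-(t / 2)) = Real.exp (-(t' / 2)) := by
    rw [← flowBox_one_one s t r, h, flowBox_one_one]
  refine mul_right_cancel₀ (Real.exp_pos (-(t / 2))).ne' ?_
  rw [← flowBox_zero_one s t r, h, flowBox_zero_one, h11]

theorem stableMatrix_zero : stableMatrix 0 = 1 :=
  ext_entries (by simp) (by simp) (by simp) (by simp)

theorem flowBox_zero_mul_inv (s s' t t' : ℝ) :
    (flowBox s' t' 0 * (flowBox s t 0)⁻¹) 1 0 = 0 ∧
      0 < (flowBox s' t' 0 * (flowBox s t 0)⁻¹) 1 1 := by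
  obtain ⟨-, h01, h10, h11⟩ := inv_entries (flowBox s t 0)
  have hz (s t : ℝ) : flowBox s t 0 1 0 = 0 :=
    (congrArg Prod.fst (bottomRow_flowBox s t 0)).trans (zero_mul _)
  have hdet := det_entries (flowBox s t 0)
  have hexp := Real.exp_pos (-(t / 2))
  have hpos : 0 < flowBox s t 0 0 0 := by
    rw [hz, flowBox_one_one, mul_zero, sub_zero] at hdet
    exact pos_of_mul_pos_left (hdet.symm ▸ one_pos) hexp.le
  constructor
  · refine (mul_entry _ _ _ _).trans ?_
    rw [h10, hz, hz]
    ring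
  · refine (mul_entry _ _ _ _).trans_gt ?_
    rw [h01, h11, hz, zero_mul, zero_add, flowBox_one_one]
    exact mul_pos (Real.exp_pos _) hpos

theorem hitDomain_unique (hg : IsCuspScaling Γ g) (hε : ε * ε = 1) {κ ℓ : Fin K} {γ : Γ}
    {x : SL(2, ℝ)} (hx : x ∈ hitDomain Γ g σ ε κ)
    (hγx : (γ : SL(2, ℝ)) * x ∈ hitDomain Γ g σ ε ℓ) : κ = ℓ ∧ γ = 1 := by
  obtain ⟨s, t, r, hs, hr, hrx, hfx⟩ := exists_eq_flowBox_of_mem_hitDomain hε hx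
  obtain ⟨s', t', r', hs', hr', hrγx, hfγx⟩ := exists_eq_flowBox_of_mem_hitDomain hε hγx
  obtain rfl : r = r' := by
    rwa [firstHit_coe_mul, ← hrx, eq_comm, ENNReal.ofReal_eq_ofReal_iff hr.le hr'.le] at hrγx
  have hconj : g ℓ * γ * (g κ)⁻¹ = flowBox s' t' 0 * (flowBox s t 0)⁻¹ := by
    rw [eq_mul_inv_iff_mul_eq, ← mul_left_inj (unstableMatrix (-(ε * r))),
      mul_assoc _ (flowBox _ _ _), ← flowBox_eq_mul, ← flowBox_eq_mul, ← hfx, ← hfγx]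
    group
  obtain ⟨h0, hpos⟩ := flowBox_zero_mul_inv s s' t t'
  rw [← hconj] at h0 hpos
  obtain rfl := eq_of_lower_left_eq_zero hg γ.2 h0
  obtain ⟨m, hm⟩ := exists_eq_stableMatrix hg γ.2 h0 hpos
  have hss : m + s = s' := by
    refine flowBox_left_injective (t := t) (t' := t') (r := 0) (r' := 0) ?_
    rw [← stableMatrix_mul_flowBox, ← hm, hconj, inv_mul_cancel_right]
  obtain rfl : m = 0 := by
    have h1 : (m : ℝ) < 1 := by linarith [hs.1, hs'.2]
    have h2 : (-1 : ℝ) < m := by linarith [hs.2, hs'.1]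
    norm_cast at h1 h2
    lia
  rw [Int.cast_zero, stableMatrix_zero, mul_inv_eq_one, mul_eq_left] at hm
  exact ⟨rfl, Subtype.ext hm⟩

theorem isFundamentalDomain_hitDomain [DiscreteTopology Γ] (hneg : (-1 : SL(2, ℝ)) ∈ Γ)
    {F : Set SL(2, ℝ)} (hF : IsFundamentalDomain Γ F Measure.haar)
    (hFfin : Measure.haar F ≠ ∞) (κ₀ : Fin K) (hg : IsCuspScaling Γ g) (σ : Fin K → ℝ)
    (hε : ε * ε = 1) :
    IsFundamentalDomain Γ (⋃ κ, hitDomain Γ g σ ε κ) (Measure.haar : Measure SL(2, ℝ)) := by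
  refine IsFundamentalDomain.mk''
    (MeasurableSet.iUnion fun κ => measurableSet_hitDomain κ).nullMeasurableSet ?_ ?_
    fun γ => (measurePreserving_smul γ _).quasiMeasurePreserving
  · filter_upwards [ae_mem_hitSet_quadrantStrip hneg hF hFfin κ₀ g σ hε] with x hx
    obtain ⟨κ, γ, hstrip, hfirst⟩ := exists_eq_firstHit hg hε hx
    obtain ⟨γ', hrow, hIco⟩ := exists_bottomRow_eq_mem_Ico hg κ γ hstrip.1.ne'
    rw [← hrow, mul_assoc] at hstrip hfirst
    rw [mul_assoc] at hIco
    exact ⟨γ', Set.mem_iUnion.2 ⟨κ, hstrip, hIco, hfirst.trans (firstHit_coe_mul γ' x).symm⟩⟩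
  · intro γ hγ
    refine Disjoint.aedisjoint (Set.disjoint_left.2 ?_)
    rintro _ ⟨x, hx, rfl⟩ hγx
    obtain ⟨κ, hκ⟩ := Set.mem_iUnion.1 hx
    obtain ⟨ℓ, hℓ⟩ := Set.mem_iUnion.1 hγx
    exact hγ (hitDomain_unique hg hε hκ hℓ).2

theorem volume_pos_ofReal_le (b : ℝ≥0∞) : volume {r : ℝ | 0 < r ∧ ENNReal.ofReal r ≤ b} = b := by
  induction b with
  | top =>
    have : {r : ℝ | 0 < r ∧ ENNReal.ofReal r ≤ ∞} = Set.Ioi 0 := by ext; simp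
    rw [this, Real.volume_Ioi]
  | coe b =>
    have : {r : ℝ | 0 < r ∧ ENNReal.ofReal r ≤ b} = Set.Ioc 0 (b : ℝ) := by
      ext r
      simp [ENNReal.ofReal_le_iff_le_toReal]
    rw [this, Real.volume_Ioc, sub_zero, ENNReal.ofReal_coe_nnreal]

/-- The ratio of Haar measure to the measure `e^{-t} ds dt dr` in flow-box coordinates. -/
def flowBoxConstant : ℝ≥0∞ := exists_lintegral_haar_eq_flowBox.choose

theorem flowBoxConstant_ne_zero : flowBoxConstant ≠ 0 :=
  exists_lintegral_haar_eq_flowBox.choose_spec.1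

theorem flowBoxConstant_ne_top : flowBoxConstant ≠ ∞ :=
  exists_lintegral_haar_eq_flowBox.choose_spec.2.1

theorem haar_eq_lintegral_volume_flowBox (a : SL(2, ℝ)) {E : Set SL(2, ℝ)} (hE : MeasurableSet E)
    (hpos : ∀ x ∈ E, 0 < (a * x) 1 1) :
    Measure.haar E = flowBoxConstant * ∫⁻ s, ∫⁻ t,
      volume {r | a⁻¹ * flowBox s t r ∈ E} * ENNReal.ofReal (Real.exp (-t)) := by
  have hE' : MeasurableSet ((a⁻¹ * ·) ⁻¹' E) := measurable_const_mul a⁻¹ hE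
  have hsub : (a⁻¹ * ·) ⁻¹' E ⊆ {x : SL(2, ℝ) | 0 < x 1 1} := fun y hy => by
    simpa using hpos _ hy
  rw [← measure_preimage_mul _ a⁻¹ E, ← Set.inter_eq_left.2 hsub, ← Measure.restrict_apply hE',
    ← lintegral_indicator_one hE', exists_lintegral_haar_eq_flowBox.choose_spec.2.2 _
      (measurable_one.indicator hE')]
  congr 1
  refine lintegral_congr fun s => lintegral_congr fun t => ?_
  rw [lintegral_mul_const' _ _ ENNReal.ofReal_ne_top]
  congr 1
  have hflow : Measurable fun r => flowBox s t r :=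
    measurable_flowBox.comp (f := fun r => (s, t, r)) (by fun_prop)
  exact lintegral_indicator_one (hflow hE')

theorem measurableSet_firstHit_le_inter_hitDomain [DiscreteTopology Γ] (κ : Fin K) (a : ℝ≥0∞) :
    MeasurableSet ({x | firstHit Γ g σ ε x ≤ a} ∩ hitDomain Γ g σ ε κ) :=
  (measurableSet_le measurable_firstHit measurable_const).inter (measurableSet_hitDomain κ)

theorem volume_flowBox_firstHit_le_inter_hitDomain (hε : ε * ε = 1) (κ : Fin K) (a : ℝ≥0∞)
    (s t : ℝ) :
    volume {r | (g κ)⁻¹ * flowBox s t r ∈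
        {x | firstHit Γ g σ ε x ≤ a} ∩ hitDomain Γ g σ ε κ} =
      (Set.Ico (0 : ℝ) 1 ×ˢ Set.Ici (σ κ)).indicator
        (fun p => min a (firstHit Γ g σ (-ε) ((g κ)⁻¹ * flowBox p.1 p.2 0))) (s, t) := by
  set E := {r | (g κ)⁻¹ * flowBox s t r ∈
    {x | firstHit Γ g σ ε x ≤ a} ∩ hitDomain Γ g σ ε κ} with hE
  have hvol : volume ((ε * ·) ⁻¹' E) = volume E := by
    rcases mul_self_eq_one_iff.1 hε with rfl | rfl <;> simp
  have hmem (r : ℝ) : ε * r ∈ E ↔ (s, t) ∈ Set.Ico (0 : ℝ) 1 ×ˢ Set.Ici (σ κ) ∧ 0 < r ∧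
      ENNReal.ofReal r ≤ min a (firstHit Γ g σ (-ε) ((g κ)⁻¹ * flowBox s t 0)) := by
    rw [hE, Set.mem_ofPred_eq, Set.mem_inter_iff, flowBox_mem_hitDomain_iff hε, Set.mem_prod,
      and_assoc, and_left_comm]
    refine and_congr_right fun _ => ?_
    rw [and_left_comm]
    refine and_congr_right fun ht => ?_
    rw [and_left_comm]
    refine and_congr_right fun hr => ?_
    rw [le_min_iff, ← ofReal_eq_firstHit_flowBox_iff hε s ht hr, Set.mem_ofPred_eq]
    exact and_congr_left fun h => by rw [h]
  rw [← hvol]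
  by_cases hst : (s, t) ∈ Set.Ico (0 : ℝ) 1 ×ˢ Set.Ici (σ κ)
  · rw [Set.indicator_of_mem hst]
    refine (congrArg volume ?_).trans (volume_pos_ofReal_le _)
    ext r
    simp only [Set.mem_preimage, hmem, hst, true_and, Set.mem_ofPred_eq]
  · rw [Set.indicator_of_notMem hst]
    convert measure_empty (μ := (volume : Measure ℝ))
    ext r
    simp only [Set.mem_preimage, hmem, hst, false_and, Set.mem_empty_iff_false]

theorem haar_hitDomain [DiscreteTopology Γ] (hε : ε * ε = 1) (κ : Fin K) (a : ℝ≥0∞) :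
    (Measure.haar : Measure SL(2, ℝ)) ({x | firstHit Γ g σ ε x ≤ a} ∩ hitDomain Γ g σ ε κ) =
      flowBoxConstant * ∫⁻ s in Set.Ico (0 : ℝ) 1, ∫⁻ t in Set.Ici (σ κ),
        min a (firstHit Γ g σ (-ε) ((g κ)⁻¹ * flowBox s t 0)) *
          ENNReal.ofReal (Real.exp (-t)) := by
  rw [haar_eq_lintegral_volume_flowBox (g κ) (measurableSet_firstHit_le_inter_hitDomain κ a)
    fun x hx => lower_right_pos_of_mem_hitDomain hx.2, ← lintegral_indicator measurableSet_Ico]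
  congr 1
  refine lintegral_congr fun s => ?_
  simp only [volume_flowBox_firstHit_le_inter_hitDomain hε]
  by_cases hs : s ∈ Set.Ico (0 : ℝ) 1
  · rw [Set.indicator_of_mem hs, ← lintegral_indicator measurableSet_Ici]
    refine lintegral_congr fun t => ?_
    simp only [Set.indicator, Set.mem_prod, hs, true_and, ite_mul, zero_mul]
  · simp only [Set.indicator, Set.mem_prod, hs, false_and, if_false, zero_mul, lintegral_zero]

theorem haar_iUnion_hitDomain [DiscreteTopology Γ] (hg : IsCuspScaling Γ g) (hε : ε * ε = 1)
    (a : ℝ≥0∞) :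
    (Measure.haar : Measure SL(2, ℝ))
        ({x | firstHit Γ g σ ε x ≤ a} ∩ ⋃ κ, hitDomain Γ g σ ε κ) =
      flowBoxConstant * sectionIntegral σ fun w =>
        min a (firstHit Γ g σ (-ε) ((g w.2.2)⁻¹ * flowBox w.1 w.2.1 0)) := by
  rw [Set.inter_iUnion, measure_iUnion ?_ fun κ => measurableSet_firstHit_le_inter_hitDomain κ a,
    tsum_fintype, sectionIntegral, Finset.mul_sum]
  · exact Finset.sum_congr rfl fun κ _ => haar_hitDomain hε κ a
  · refine fun κ ℓ hne => Set.disjoint_left.2 fun x hx hx' => hne ?_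
    exact (hitDomain_unique (γ := 1) hg hε hx.2 (by simpa using hx'.2)).1

end HitDomain

/-! ### Equidistribution of the extreme value events -/

section Equidistribution

variable {Γ : Subgroup SL(2, ℝ)} {K : ℕ} {g : Fin K → SL(2, ℝ)}

theorem isLinearMap_fst_sub_mul_snd (m : ℝ) : IsLinearMap ℝ fun v : ℝ × ℝ => v.1 - m * v.2 :=
  (LinearMap.fst ℝ ℝ ℝ - m • LinearMap.snd ℝ ℝ ℝ).isLinear

theorem extremeRegion_eq_inter (σ : Fin K → ℝ) (H : ℝ) (κ : Fin K) : extremeRegion σ H κ =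
    ({v | 0 < v.2} ∩ {v | v.2 < Real.exp (-(σ κ / 2))} ∩ {v | 0 < v.1}) ∩
      {v | v.1 - Real.exp (-H) * v.2 ≤ 0} := by
  ext v
  simp [extremeRegion, and_assoc]

theorem thickRegion_eq_inter (σ : Fin K → ℝ) (H ε : ℝ) (κ : Fin K) : thickRegion σ H ε κ =
    {v | 0 ≤ v.2} ∩ {v | v.2 ≤ Real.exp (-(σ κ / 2))} ∩ {v | -ε ≤ v.1} ∩
      {v | v.1 - Real.exp (-H) * v.2 ≤ ε} := by
  ext v
  simp [thickRegion, and_assoc, add_comm]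

theorem convex_extremeRegion (σ : Fin K → ℝ) (H : ℝ) (κ : Fin K) :
    Convex ℝ (extremeRegion σ H κ) := by
  have hfst := (LinearMap.fst ℝ ℝ ℝ).isLinear
  have hsnd := (LinearMap.snd ℝ ℝ ℝ).isLinear
  rw [extremeRegion_eq_inter]
  exact (((convex_halfSpace_gt hsnd _).inter (convex_halfSpace_lt hsnd _)).inter
    (convex_halfSpace_gt hfst _)).inter (convex_halfSpace_le (isLinearMap_fst_sub_mul_snd _) _)

theorem convex_thickRegion (σ : Fin K → ℝ) (H ε : ℝ) (κ : Fin K) :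
    Convex ℝ (thickRegion σ H ε κ) := by
  have hfst := (LinearMap.fst ℝ ℝ ℝ).isLinear
  have hsnd := (LinearMap.snd ℝ ℝ ℝ).isLinear
  rw [thickRegion_eq_inter]
  exact (((convex_halfSpace_ge hsnd _).inter (convex_halfSpace_le hsnd _)).inter
    (convex_halfSpace_ge hfst _)).inter (convex_halfSpace_le (isLinearMap_fst_sub_mul_snd _) _)

theorem isClosed_thickRegion (σ : Fin K → ℝ) (H ε : ℝ) (κ : Fin K) :
    IsClosed (thickRegion σ H ε κ) := by
  rw [thickRegion_eq_inter]
  exact (((isClosed_le continuous_const continuous_snd).inter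
    (isClosed_le continuous_snd continuous_const)).inter
    (isClosed_le continuous_const continuous_fst)).inter
    (isClosed_le (by fun_prop) continuous_const)

theorem isBounded_thickRegion (σ : Fin K → ℝ) (H ε : ℝ) (κ : Fin K) :
    Bornology.IsBounded (thickRegion σ H ε κ) := by
  refine (Metric.isBounded_Icc ((-ε, 0) : ℝ × ℝ)
    (Real.exp (-H) * Real.exp (-(σ κ / 2)) + ε, Real.exp (-(σ κ / 2)))).subset ?_
  rintro v ⟨h0, h1, h2, h3⟩
  exact ⟨⟨h2, h0⟩, h3.trans
    (add_le_add_left (mul_le_mul_of_nonneg_left h1 (Real.exp_pos _).le) ε), h1⟩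

theorem extremeRegion_subset_thickRegion (σ : Fin K → ℝ) (H : ℝ) (κ : Fin K) :
    extremeRegion σ H κ ⊆ thickRegion σ H 0 κ := fun _ ⟨h1, h2, h3, h4⟩ =>
  ⟨h1.le, h2.le, by simpa using h3.le, by simpa using h4⟩

theorem isBounded_extremeRegion (σ : Fin K → ℝ) (H : ℝ) (κ : Fin K) :
    Bornology.IsBounded (extremeRegion σ H κ) :=
  (isBounded_thickRegion σ H 0 κ).subset (extremeRegion_subset_thickRegion σ H κ)

theorem thickRegion_mono (σ : Fin K → ℝ) (H : ℝ) (κ : Fin K) :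
    Monotone fun ε => thickRegion σ H ε κ := fun _ _ hε _ ⟨h1, h2, h3, h4⟩ =>
  ⟨h1, h2, (neg_le_neg hε).trans h3, h4.trans (add_le_add_right hε _)⟩

theorem iInter_thickRegion (σ : Fin K → ℝ) (H : ℝ) (κ : Fin K) :
    ⋂ n : ℕ, thickRegion σ H (1 / (n + 1)) κ = thickRegion σ H 0 κ := by
  refine Set.Subset.antisymm (fun v hv => ?_)
    (Set.subset_iInter fun n => thickRegion_mono σ H κ (by positivity))
  rw [Set.mem_iInter] at hv
  have hlim : Tendsto (fun n : ℕ => (1 : ℝ) / (n + 1)) atTop (𝓝 0) :=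
    tendsto_one_div_add_atTop_nhds_zero_nat
  exact ⟨(hv 0).1, (hv 0).2.1,
    le_of_tendsto hlim.neg (Eventually.of_forall fun n => (hv n).2.2.1),
    ge_of_tendsto (hlim.const_add _) (Eventually.of_forall fun n => (hv n).2.2.2)⟩

theorem volume_thickRegion_diff (σ : Fin K → ℝ) (H : ℝ) (κ : Fin K) :
    volume (thickRegion σ H 0 κ \ extremeRegion σ H κ) = 0 := by
  have hhor (a : ℝ) : volume (Set.univ ×ˢ {a} : Set (ℝ × ℝ)) = 0 := by
    simp [Measure.volume_eq_prod, Measure.prod_prod]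
  have hvert (a : ℝ) : volume ({a} ×ˢ Set.univ : Set (ℝ × ℝ)) = 0 := by
    simp [Measure.volume_eq_prod, Measure.prod_prod]
  refine measure_mono_null ?_ (measure_union_null (measure_union_null (hhor 0)
    (hhor (Real.exp (-(σ κ / 2))))) (hvert 0))
  rintro v ⟨⟨h1, h2, h3, h4⟩, hn⟩
  by_contra hcon
  simp only [Set.mem_union, Set.mem_prod, Set.mem_univ, Set.mem_singleton_iff, true_and, and_true,
    not_or] at hcon
  obtain ⟨⟨hbot, htop⟩, hleft⟩ := hcon
  exact hn ⟨h1.lt_of_ne' hbot, h2.lt_of_ne htop,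
    lt_of_le_of_ne (by simpa using h3) (Ne.symm hleft), by simpa using h4⟩

theorem measurableSet_hitQuot_extremeRegion [DiscreteTopology Γ] (hg : IsCuspScaling Γ g)
    (σ : Fin K → ℝ) (H : ℝ) : MeasurableSet (hitQuot Γ g (extremeRegion σ H)) := by
  have hb := isBounded_extremeRegion σ H
  simp only [extremeRegion_eq_inter] at hb
  rw [funext (extremeRegion_eq_inter σ H)]
  exact measurableSet_hitQuot hg hb
    (fun _ => ((isOpen_lt continuous_const continuous_snd).inter
      (isOpen_lt continuous_snd continuous_const)).inter
      (isOpen_lt continuous_const continuous_fst))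
    fun _ => isClosed_le (by fun_prop) continuous_const

theorem measurableSet_hitQuot_thickRegion [DiscreteTopology Γ] (hg : IsCuspScaling Γ g)
    (σ : Fin K → ℝ) (H ε : ℝ) : MeasurableSet (hitQuot Γ g (thickRegion σ H ε)) :=
  (isClosed_hitQuot hg (isBounded_thickRegion σ H ε) (isClosed_thickRegion σ H ε)).measurableSet

theorem haar_hitSet_inter_congr [DiscreteTopology Γ] {R R' : Fin K → Set (ℝ × ℝ)}
    (hR : ∀ κ, R κ ⊆ R' κ) (h0 : ∀ κ, volume (R' κ \ R κ) = 0) (F : Set SL(2, ℝ)) :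
    (Measure.haar : Measure SL(2, ℝ)) (hitSet Γ g R ∩ F) = Measure.haar (hitSet Γ g R' ∩ F) := by
  refine le_antisymm (measure_mono (Set.inter_subset_inter_left _ (hitSet_mono hR))) ?_
  have hsub : hitSet Γ g R' ∩ F ⊆ (hitSet Γ g R ∩ F) ∪ hitSet Γ g fun κ => R' κ \ R κ := by
    rintro x ⟨⟨κ, γ, hx⟩, hxF⟩
    by_cases h : bottomRow (g κ * γ * x) ∈ R κ
    · exact Or.inl ⟨⟨κ, γ, h⟩, hxF⟩
    · exact Or.inr ⟨κ, γ, hx, h⟩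
  refine (measure_mono hsub).trans ((measure_union_le _ _).trans ?_)
  rw [haar_hitSet_null h0, add_zero]

theorem liouville_hitQuot_thickRegion_zero [DiscreteTopology Γ] (hg : IsCuspScaling Γ g)
    (F : Set SL(2, ℝ)) (σ : Fin K → ℝ) (H : ℝ) :
    liouville Γ F (hitQuot Γ g (thickRegion σ H 0)) =
      liouville Γ F (hitQuot Γ g (extremeRegion σ H)) := by
  rw [liouville_apply (measurableSet_hitQuot_thickRegion hg σ H 0),
    liouville_apply (measurableSet_hitQuot_extremeRegion hg σ H), mk_preimage_hitQuot,
    mk_preimage_hitQuot, haar_hitSet_inter_congr (extremeRegion_subset_thickRegion σ H)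
      (volume_thickRegion_diff σ H)]

theorem iInter_hitSet [DiscreteTopology Γ] (hg : IsCuspScaling Γ g)
    {R : ℕ → Fin K → Set (ℝ × ℝ)} (hR : Antitone R) (hb : ∀ κ, Bornology.IsBounded (R 0 κ)) :
    ⋂ n, hitSet Γ g (R n) = hitSet Γ g fun κ => ⋂ n, R n κ := by
  refine Set.Subset.antisymm (fun x hx => ?_)
    (Set.subset_iInter fun n => hitSet_mono fun κ => Set.iInter_subset _ n)
  let A (n : ℕ) : Set (Fin K × (ℝ × ℝ)) := {p | p.2 ∈ cuspOrbit Γ g p.1 ∧ rowAct x p.2 ∈ R n p.1}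
  have hfin (n : ℕ) : (A n).Finite :=
    finite_cuspOrbits_rowAct_mem hg x fun κ => (hb κ).subset (hR n.zero_le κ)
  have hne : (⋂ n, A n).Nonempty := by
    refine IsCompact.nonempty_iInter_of_sequence_nonempty_isCompact_isClosed A
      (fun n p hp => ⟨hp.1, hR n.le_succ _ hp.2⟩) (fun n => ?_) (hfin 0).isCompact
      fun n => (hfin n).isClosed
    obtain ⟨κ, γ, h⟩ := Set.mem_iInter.1 hx n
    exact ⟨(κ, bottomRow (g κ * γ)), ⟨γ, rfl⟩, bottomRow_mul _ x ▸ h⟩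
  obtain ⟨⟨κ, v⟩, hv⟩ := hne
  rw [Set.mem_iInter] at hv
  obtain ⟨γ, hγ⟩ := (hv 0).1
  obtain rfl : bottomRow (g κ * γ) = v := hγ
  exact ⟨κ, γ, Set.mem_iInter.2 fun n => bottomRow_mul _ x ▸ (hv n).2⟩

theorem iInter_hitQuot [DiscreteTopology Γ] (hg : IsCuspScaling Γ g)
    {R : ℕ → Fin K → Set (ℝ × ℝ)} (hR : Antitone R) (hb : ∀ κ, Bornology.IsBounded (R 0 κ)) :
    ⋂ n, hitQuot Γ g (R n) = hitQuot Γ g fun κ => ⋂ n, R n κ := by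
  refine mk_surjective.preimage_injective ?_
  simp only [Set.preimage_iInter, mk_preimage_hitQuot, iInter_hitSet hg hR hb]

theorem tendsto_liouville_thickRegion [DiscreteTopology Γ] (hg : IsCuspScaling Γ g)
    (F : Set SL(2, ℝ)) [IsFiniteMeasure (liouville Γ F)] (σ : Fin K → ℝ) (H : ℝ) :
    Tendsto (fun n : ℕ => (liouville Γ F).real (hitQuot Γ g (thickRegion σ H (1 / (n + 1)))))
      atTop (𝓝 ((liouville Γ F).real (hitQuot Γ g (extremeRegion σ H)))) := by
  have hanti : Antitone fun (n : ℕ) => thickRegion σ H (1 / (n + 1)) := fun m n hmn κ =>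
    thickRegion_mono σ H κ (Nat.one_div_le_one_div hmn)
  have hinter : ⋂ n : ℕ, hitQuot Γ g (thickRegion σ H (1 / (n + 1))) =
      hitQuot Γ g (thickRegion σ H 0) := by
    rw [iInter_hitQuot hg hanti fun κ => isBounded_thickRegion σ H _ κ,
      funext (iInter_thickRegion σ H)]
  rw [measureReal_def, ← liouville_hitQuot_thickRegion_zero hg, ← hinter]
  exact (ENNReal.tendsto_toReal (measure_ne_top _ _)).comp (tendsto_measure_iInter_atTop
    (fun n => (measurableSet_hitQuot_thickRegion hg σ H _).nullMeasurableSet)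
    (fun m n hmn => hitQuot_mono (hanti hmn)) ⟨0, measure_ne_top _ _⟩)

theorem tendsto_add_log_atTop (H : ℝ) : Tendsto (fun T => H + Real.log T) atTop atTop :=
  tendsto_atTop_add_const_left _ _ Real.tendsto_log_atTop

theorem tendsto_geodesicFlow_hitQuot [DiscreteTopology Γ] (hg : IsCuspScaling Γ g)
    {F : Set SL(2, ℝ)} [IsFiniteMeasure (liouville Γ F)] {lam : Measure (UnitTangent Γ)}
    (hlam : IsAdmissible (liouville Γ F) lam) {R : Fin K → Set (ℝ × ℝ)}
    (hb : ∀ κ, Bornology.IsBounded (R κ)) (hc : ∀ κ, Convex ℝ (R κ))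
    (hm : MeasurableSet (hitQuot Γ g R)) :
    Tendsto (fun t : ℝ => lam.real (geodesicFlow t '' hitQuot Γ g R)) atTop
      (𝓝 ((liouville Γ F).real (hitQuot Γ g R))) :=
  (ENNReal.tendsto_toReal (measure_ne_top _ _)).comp
    (hlam _ hm (liouville_frontier_hitQuot hg F hb fun κ => (hc κ).addHaar_frontier _))

theorem tendsto_geodesicFlow_extremeRegion [DiscreteTopology Γ] (hg : IsCuspScaling Γ g)
    {F : Set SL(2, ℝ)} [IsFiniteMeasure (liouville Γ F)] {lam : Measure (UnitTangent Γ)}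
    (hlam : IsAdmissible (liouville Γ F) lam) (σ : Fin K → ℝ) (H : ℝ) :
    Tendsto (fun T => lam.real (geodesicFlow (H + Real.log T) '' hitQuot Γ g (extremeRegion σ H)))
      atTop (𝓝 ((liouville Γ F).real (hitQuot Γ g (extremeRegion σ H)))) :=
  (tendsto_geodesicFlow_hitQuot hg hlam (isBounded_extremeRegion σ H) (convex_extremeRegion σ H)
    (measurableSet_hitQuot_extremeRegion hg σ H)).comp (tendsto_add_log_atTop H)

theorem tendsto_sectionExtreme [DiscreteTopology Γ] (hg : IsCuspScaling Γ g)
    {F : Set SL(2, ℝ)} [IsFiniteMeasure (liouville Γ F)] {lam : Measure (UnitTangent Γ)}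
    (hlam : IsAdmissible (liouville Γ F) lam) (σ : Fin K → ℝ) (H : ℝ) :
    Tendsto (fun T : ℝ => lam.real {x₀ | ((H + Real.log T : ℝ) : EReal) <
        ⨆ ξ ∈ hittingTimes g σ 0 x₀ ∩ Set.Icc 0 T, relHeight g σ (unstableFlow ξ x₀)})
      atTop (𝓝 ((liouville Γ F).real (hitQuot Γ g (extremeRegion σ H)))) := by
  refine (tendsto_geodesicFlow_extremeRegion hg hlam σ H).congr' ?_
  filter_upwards [eventually_gt_atTop 0, (tendsto_add_log_atTop H).eventually_ge_atTop 0]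
    with T hT hHT
  rw [sectionExtreme_eq hg σ hT hHT]

theorem eventually_exp_mul_exp_neg_le (c H : ℝ) {ε : ℝ} (hε : 0 < ε) :
    ∀ᶠ T : ℝ in atTop, Real.exp c * Real.exp (-(H + Real.log T)) ≤ ε := by
  have hlim := (Real.tendsto_exp_neg_atTop_nhds_zero.comp (tendsto_add_log_atTop H)).const_mul
    (Real.exp c)
  rw [mul_zero] at hlim
  exact hlim.eventually_le_const hε

theorem tendsto_surfaceExtreme [DiscreteTopology Γ] (hneg : (-1 : SL(2, ℝ)) ∈ Γ)
    (hg : IsCuspScaling Γ g) {F : Set SL(2, ℝ)} [IsFiniteMeasure (liouville Γ F)]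
    {lam : Measure (UnitTangent Γ)} [IsFiniteMeasure lam]
    (hlam : IsAdmissible (liouville Γ F) lam) (σ : Fin K → ℝ) (H : ℝ) :
    Tendsto (fun T : ℝ => lam.real {x₀ | ((H + Real.log T : ℝ) : EReal) <
        ⨆ s ∈ Set.Icc 0 T, relHeightSurface g σ (proj (unstableFlow s x₀))})
      atTop (𝓝 ((liouville Γ F).real (hitQuot Γ g (extremeRegion σ H)))) := by
  refine tendsto_order.2 ⟨fun b hb => ?_, fun b hb => ?_⟩
  · filter_upwards [(tendsto_sectionExtreme hg hlam σ H).eventually_const_lt hb] with T hlow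
    exact hlow.trans_le (measureReal_mono (sectionExtreme_subset_surfaceExtreme σ _ T))
  · obtain ⟨n, hn⟩ := ((tendsto_liouville_thickRegion hg F σ H).eventually_lt_const hb).exists
    have hup := (tendsto_geodesicFlow_hitQuot hg hlam (isBounded_thickRegion σ H (1 / (n + 1)))
      (convex_thickRegion σ H _) (measurableSet_hitQuot_thickRegion hg σ H _)).comp
      (tendsto_add_log_atTop H)
    filter_upwards [hup.eventually_lt_const hn, eventually_gt_atTop 0,
      (tendsto_add_log_atTop H).eventually_ge_atTop 0, eventually_all.2 fun κ =>
        eventually_exp_mul_exp_neg_le (-(σ κ / 2)) H (Nat.one_div_pos_of_nat (n := n))]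
      with T hlt hT hHT hε
    exact (measureReal_mono (surfaceExtreme_subset hneg hg σ hT hHT hε)).trans_lt hlt

end Equidistribution

/-! ### The limit density -/

section LimitDensity

variable {Γ : Subgroup SL(2, ℝ)} {K : ℕ} {g : Fin K → SL(2, ℝ)} {σ : Fin K → ℝ}
  {F : Set SL(2, ℝ)}

theorem haar_firstHit_le_inter [DiscreteTopology Γ] (hneg : (-1 : SL(2, ℝ)) ∈ Γ)
    (hF : IsFundamentalDomain Γ F Measure.haar) (hFfin : Measure.haar F ≠ ∞) (κ₀ : Fin K)
    (hg : IsCuspScaling Γ g) (σ : Fin K → ℝ) {ε : ℝ} (hε : ε * ε = 1) (a : ℝ≥0∞) :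
    Measure.haar ({x | firstHit Γ g σ ε x ≤ a} ∩ F) = flowBoxConstant * sectionIntegral σ fun w =>
      min a (firstHit Γ g σ (-ε) ((g w.2.2)⁻¹ * flowBox w.1 w.2.1 0)) := by
  have : Countable Γ := countable_of_discreteTopology (Γ : Set SL(2, ℝ))
  rw [← haar_iUnion_hitDomain hg hε a]
  refine hF.measure_set_eq (isFundamentalDomain_hitDomain hneg hF hFfin κ₀ hg σ hε)
    (measurableSet_le measurable_firstHit measurable_const) fun γ => Set.ext fun x => ?_
  simp only [Set.mem_preimage, Set.mem_ofPred_eq, Subgroup.smul_def, smul_eq_mul,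
    firstHit_coe_mul]

theorem haar_eq_sectionIntegral_firstHit [DiscreteTopology Γ] (hneg : (-1 : SL(2, ℝ)) ∈ Γ)
    (hF : IsFundamentalDomain Γ F Measure.haar) (hFfin : Measure.haar F ≠ ∞) (κ₀ : Fin K)
    (hg : IsCuspScaling Γ g) (σ : Fin K → ℝ) {ε : ℝ} (hε : ε * ε = 1) :
    Measure.haar F = flowBoxConstant * sectionIntegral σ fun w =>
      firstHit Γ g σ (-ε) ((g w.2.2)⁻¹ * flowBox w.1 w.2.1 0) := by
  simpa only [le_top, Set.ofPred_true, Set.univ_inter, min_eq_right] using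
    haar_firstHit_le_inter hneg hF hFfin κ₀ hg σ hε ∞

theorem haar_eq_meanReturnTime [DiscreteTopology Γ] (hneg : (-1 : SL(2, ℝ)) ∈ Γ)
    (hF : IsFundamentalDomain Γ F Measure.haar) (hFfin : Measure.haar F ≠ ∞) (κ₀ : Fin K)
    (hg : IsCuspScaling Γ g) (σ : Fin K → ℝ) :
    Measure.haar F = flowBoxConstant * meanReturnTime Γ g σ := by
  rw [haar_eq_sectionIntegral_firstHit hneg hF hFfin κ₀ hg σ
    ((neg_one_mul (-1 : ℝ)).trans (neg_neg 1)), meanReturnTime, neg_neg]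
  simp only [← returnTime_eq_firstHit]

theorem haar_eq_sectionIntegral_backwardReturnTime [DiscreteTopology Γ]
    (hneg : (-1 : SL(2, ℝ)) ∈ Γ) (hF : IsFundamentalDomain Γ F Measure.haar)
    (hFfin : Measure.haar F ≠ ∞) (κ₀ : Fin K) (hg : IsCuspScaling Γ g) (σ : Fin K → ℝ) :
    Measure.haar F = flowBoxConstant * sectionIntegral σ (backwardReturnTime Γ g σ) := by
  rw [haar_eq_sectionIntegral_firstHit hneg hF hFfin κ₀ hg σ (one_mul 1)]
  simp only [← backwardReturnTime_eq_firstHit]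

theorem meanReturnTime_ne_zero [DiscreteTopology Γ] (hneg : (-1 : SL(2, ℝ)) ∈ Γ)
    (hF : IsFundamentalDomain Γ F Measure.haar) (hFfin : Measure.haar F ≠ ∞) (κ₀ : Fin K)
    (hg : IsCuspScaling Γ g) (σ : Fin K → ℝ) : meanReturnTime Γ g σ ≠ 0 := by
  have : Countable Γ := countable_of_discreteTopology (Γ : Set SL(2, ℝ))
  have hF0 : Measure.haar F ≠ 0 := hF.measure_ne_zero (NeZero.ne _)
  exact right_ne_zero_of_mul (haar_eq_meanReturnTime hneg hF hFfin κ₀ hg σ ▸ hF0)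

theorem meanReturnTime_ne_top [DiscreteTopology Γ] (hneg : (-1 : SL(2, ℝ)) ∈ Γ)
    (hF : IsFundamentalDomain Γ F Measure.haar) (hFfin : Measure.haar F ≠ ∞) (κ₀ : Fin K)
    (hg : IsCuspScaling Γ g) (σ : Fin K → ℝ) : meanReturnTime Γ g σ ≠ ∞ := fun h =>
  hFfin (by rw [haar_eq_meanReturnTime hneg hF hFfin κ₀ hg σ, h,
    ENNReal.mul_top flowBoxConstant_ne_zero])

theorem sectionIntegral_backwardReturnTime [DiscreteTopology Γ] (hneg : (-1 : SL(2, ℝ)) ∈ Γ)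
    (hF : IsFundamentalDomain Γ F Measure.haar) (hFfin : Measure.haar F ≠ ∞) (κ₀ : Fin K)
    (hg : IsCuspScaling Γ g) (σ : Fin K → ℝ) :
    sectionIntegral σ (backwardReturnTime Γ g σ) = meanReturnTime Γ g σ :=
  (ENNReal.mul_right_inj flowBoxConstant_ne_zero flowBoxConstant_ne_top).1
    ((haar_eq_sectionIntegral_backwardReturnTime hneg hF hFfin κ₀ hg σ).symm.trans
      (haar_eq_meanReturnTime hneg hF hFfin κ₀ hg σ))

theorem hitSet_eq_firstHit_le [DiscreteTopology Γ] (hg : IsCuspScaling Γ g) (σ : Fin K → ℝ)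
    (H : ℝ) : hitSet Γ g (fun κ => quadrantStrip σ 1 κ ∩ {v | v.1 ≤ Real.exp (-H) * v.2}) =
      {x | firstHit Γ g σ 1 x ≤ ENNReal.ofReal (Real.exp (-H))} := by
  ext x
  constructor
  · rintro ⟨κ, γ, hstrip, hle⟩
    refine (firstHit_le hstrip).trans (ENNReal.ofReal_le_ofReal ?_)
    rwa [one_mul, div_le_iff₀ hstrip.1]
  · intro (hx : firstHit Γ g σ 1 x ≤ ENNReal.ofReal (Real.exp (-H)))
    have hmem : x ∈ hitSet Γ g (quadrantStrip σ 1) := by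
      by_contra hcon
      have htop : ⊤ ≤ firstHit Γ g σ 1 x :=
        le_firstHit_iff.2 fun κ γ h => (hcon ⟨κ, γ, h⟩).elim
      exact ENNReal.ofReal_ne_top (top_le_iff.1 (htop.trans hx))
    obtain ⟨κ, γ, hstrip, heq⟩ := exists_eq_firstHit hg (one_mul 1) hmem
    rw [← heq, one_mul, ENNReal.ofReal_le_ofReal_iff (Real.exp_pos _).le,
      div_le_iff₀ hstrip.1] at hx
    exact ⟨κ, γ, hstrip, hx⟩

theorem haar_hitSet_extremeRegion_inter [DiscreteTopology Γ] (hneg : (-1 : SL(2, ℝ)) ∈ Γ)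
    (hF : IsFundamentalDomain Γ F Measure.haar) (hFfin : Measure.haar F ≠ ∞) (κ₀ : Fin K)
    (hg : IsCuspScaling Γ g) (σ : Fin K → ℝ) (H : ℝ) :
    Measure.haar (hitSet Γ g (extremeRegion σ H) ∩ F) = flowBoxConstant * sectionIntegral σ fun w =>
      min (ENNReal.ofReal (Real.exp (-H))) (backwardReturnTime Γ g σ w) := by
  have hsub (κ : Fin K) : extremeRegion σ H κ ⊆
      quadrantStrip σ 1 κ ∩ {v | v.1 ≤ Real.exp (-H) * v.2} := fun _ ⟨h1, h2, h3, h4⟩ =>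
    ⟨⟨h1, h2.le, by simpa using h3⟩, h4⟩
  have hnull (κ : Fin K) : volume
      ((quadrantStrip σ 1 κ ∩ {v | v.1 ≤ Real.exp (-H) * v.2}) \ extremeRegion σ H κ) = 0 := by
    refine measure_mono_null (Set.sdiff_subset_sdiff_left ?_) (volume_thickRegion_diff σ H κ)
    rintro v ⟨⟨h1, h2, h3⟩, h4⟩
    exact ⟨h1.le, h2, by simpa using (one_mul v.1 ▸ h3).le, by simpa using h4⟩
  rw [haar_hitSet_inter_congr hsub hnull, hitSet_eq_firstHit_le hg,
    haar_firstHit_le_inter hneg hF hFfin κ₀ hg σ (one_mul 1)]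
  simp only [← backwardReturnTime_eq_firstHit]

theorem isProbabilityMeasure_liouville [DiscreteTopology Γ]
    (hF : IsFundamentalDomain Γ F Measure.haar) (hFfin : Measure.haar F ≠ ∞) :
    IsProbabilityMeasure (liouville Γ F) := by
  have : Countable Γ := countable_of_discreteTopology (Γ : Set SL(2, ℝ))
  refine ⟨?_⟩
  rw [liouville_apply MeasurableSet.univ, Set.preimage_univ, Set.univ_inter,
    ENNReal.inv_mul_cancel (hF.measure_ne_zero (NeZero.ne _)) hFfin]

theorem liouville_hitQuot_extremeRegion [DiscreteTopology Γ] (hneg : (-1 : SL(2, ℝ)) ∈ Γ)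
    (hF : IsFundamentalDomain Γ F Measure.haar) (hFfin : Measure.haar F ≠ ∞) (κ₀ : Fin K)
    (hg : IsCuspScaling Γ g) (σ : Fin K → ℝ) (H : ℝ) :
    liouville Γ F (hitQuot Γ g (extremeRegion σ H)) =
      (meanReturnTime Γ g σ)⁻¹ * sectionIntegral σ fun w =>
        min (ENNReal.ofReal (Real.exp (-H))) (backwardReturnTime Γ g σ w) := by
  rw [liouville_apply (measurableSet_hitQuot_extremeRegion hg σ H), mk_preimage_hitQuot,
    haar_hitSet_extremeRegion_inter hneg hF hFfin κ₀ hg, haar_eq_meanReturnTime hneg hF hFfin κ₀ hg,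
    ENNReal.mul_inv (Or.inl flowBoxConstant_ne_zero) (Or.inl flowBoxConstant_ne_top),
    mul_mul_mul_comm, ENNReal.inv_mul_cancel flowBoxConstant_ne_zero flowBoxConstant_ne_top,
    one_mul]

theorem measurable_backwardReturnTime [DiscreteTopology Γ] (κ : Fin K) :
    Measurable fun p : ℝ × ℝ => backwardReturnTime Γ g σ (p.1, p.2, κ) := by
  simp only [backwardReturnTime_eq_firstHit]
  have hflow : Measurable fun p : ℝ × ℝ => flowBox p.1 p.2 0 :=
    measurable_flowBox.comp (g := fun p : ℝ × ℝ × ℝ => flowBox p.1 p.2.1 p.2.2)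
      (f := fun p : ℝ × ℝ => (p.1, p.2, 0)) (by fun_prop)
  exact measurable_firstHit.comp (hflow.const_mul _)

theorem sectionIntegral_const_mul {a : ℝ≥0∞} (ha : a ≠ ∞) (f : ℝ × ℝ × Fin K → ℝ≥0∞) :
    sectionIntegral σ (fun w => a * f w) = a * sectionIntegral σ f := by
  simp only [sectionIntegral, Finset.mul_sum, mul_assoc, lintegral_const_mul' _ _ ha]

theorem sectionIntegral_mono {f f' : ℝ × ℝ × Fin K → ℝ≥0∞} (h : ∀ w, f w ≤ f' w) :
    sectionIntegral σ f ≤ sectionIntegral σ f' :=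
  Finset.sum_le_sum fun _ _ => lintegral_mono fun _ => lintegral_mono fun _ =>
    mul_le_mul_left (h _) _

theorem sectionIntegral_one_ne_top : sectionIntegral σ (fun _ => 1) ≠ ∞ := by
  refine ENNReal.sum_ne_top.2 fun κ _ => ?_
  have hint : ∫⁻ t in Set.Ici (σ κ), 1 * ENNReal.ofReal (Real.exp (-t)) < ∞ := by
    simp only [one_mul]
    exact ((integrableOn_Ici_iff_integrableOn_Ioi).2
      (integrableOn_exp_neg_Ioi (σ κ))).lintegral_lt_top
  rw [setLIntegral_const, Real.volume_Ico]
  exact ENNReal.mul_ne_top hint.ne (by simp)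

open Classical in
/-- The unnormalised joint density: the indicator of the event that the backward return time
exceeds `r`. -/
def survival (Γ : Subgroup SL(2, ℝ)) (g : Fin K → SL(2, ℝ)) (σ : Fin K → ℝ) (r : ℝ)
    (w : ℝ × ℝ × Fin K) : ℝ≥0∞ :=
  if ENNReal.ofReal r < backwardReturnTime Γ g σ w then 1 else 0

theorem survival_le_one (r : ℝ) (w : ℝ × ℝ × Fin K) : survival Γ g σ r w ≤ 1 := by
  unfold survival
  split_ifs <;> simp

theorem measurable_survival [DiscreteTopology Γ] (κ : Fin K) :
    Measurable fun q : (ℝ × ℝ) × ℝ => survival Γ g σ q.1.1 (q.1.2, q.2, κ) := by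
  unfold survival
  refine Measurable.ite (measurableSet_lt (by fun_prop) ?_) measurable_const measurable_const
  exact (measurable_backwardReturnTime κ).comp (f := fun q : (ℝ × ℝ) × ℝ => (q.1.2, q.2))
    (by fun_prop)

theorem measurable_lintegral_survival [DiscreteTopology Γ] (κ : Fin K) :
    Measurable fun q : ℝ × ℝ => ∫⁻ t in Set.Ici (σ κ),
      survival Γ g σ q.1 (q.2, t, κ) * ENNReal.ofReal (Real.exp (-t)) :=
  ((measurable_survival κ).mul (by fun_prop)).lintegral_prod_right'
    (f := fun q : (ℝ × ℝ) × ℝ => survival Γ g σ q.1.1 (q.1.2, q.2, κ) *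
      ENNReal.ofReal (Real.exp (-q.2)))

theorem measurable_sectionIntegral_survival [DiscreteTopology Γ] :
    Measurable fun r => sectionIntegral σ (survival Γ g σ r) :=
  Finset.measurable_sum _ fun κ _ => (measurable_lintegral_survival κ).lintegral_prod_right'

theorem volume_pos_ofReal_lt (b : ℝ≥0∞) : volume {r : ℝ | 0 < r ∧ ENNReal.ofReal r < b} = b := by
  induction b with
  | top =>
    have : {r : ℝ | 0 < r ∧ ENNReal.ofReal r < ∞} = Set.Ioi 0 := by ext; simp
    rw [this, Real.volume_Ioi]
  | coe b =>
    have : {r : ℝ | 0 < r ∧ ENNReal.ofReal r < b} = Set.Ioo 0 (b : ℝ) := by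
      ext r
      refine and_congr_right fun hr => ?_
      rw [← ENNReal.ofReal_coe_nnreal, ENNReal.ofReal_lt_ofReal_iff_of_nonneg hr.le]
    rw [this, Real.volume_Ioo, sub_zero, ENNReal.ofReal_coe_nnreal]

theorem measurableSet_pos_ofReal_lt (b : ℝ≥0∞) :
    MeasurableSet {r : ℝ | 0 < r ∧ ENNReal.ofReal r < b} :=
  (measurableSet_lt measurable_const measurable_id).inter
    (measurableSet_lt ENNReal.measurable_ofReal measurable_const)

theorem lintegral_survival (b : ℝ≥0∞) (w : ℝ × ℝ × Fin K) :
    ∫⁻ r in {r : ℝ | 0 < r ∧ ENNReal.ofReal r < b}, survival Γ g σ r w =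
      min b (backwardReturnTime Γ g σ w) := by
  have hset : (Set.indicator {r : ℝ | 0 < r ∧ ENNReal.ofReal r < b} fun r => survival Γ g σ r w) =
      Set.indicator {r : ℝ | 0 < r ∧ ENNReal.ofReal r < min b (backwardReturnTime Γ g σ w)} 1 := by
    ext r
    by_cases h1 : 0 < r <;> by_cases h2 : ENNReal.ofReal r < b <;>
      by_cases h3 : ENNReal.ofReal r < backwardReturnTime Γ g σ w <;>
      simp [Set.indicator, survival, h1, h2, h3]
  rw [← lintegral_indicator (measurableSet_pos_ofReal_lt b), hset,
    lintegral_indicator_one (measurableSet_pos_ofReal_lt _), volume_pos_ofReal_lt]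

theorem lintegral_sectionIntegral_survival [DiscreteTopology Γ] (b : ℝ≥0∞) :
    ∫⁻ r in {r : ℝ | 0 < r ∧ ENNReal.ofReal r < b}, sectionIntegral σ (survival Γ g σ r) =
      sectionIntegral σ fun w => min b (backwardReturnTime Γ g σ w) := by
  simp only [sectionIntegral]
  rw [lintegral_finsetSum _ fun κ _ => (measurable_lintegral_survival κ).lintegral_prod_right']
  refine Finset.sum_congr rfl fun κ _ => ?_
  rw [lintegral_lintegral_swap (measurable_lintegral_survival κ).aemeasurable]
  refine lintegral_congr fun s => ?_
  have hsurvival : Measurable fun q : ℝ × ℝ => survival Γ g σ q.1 (s, q.2, κ) :=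
    (measurable_survival κ).comp (f := fun q : ℝ × ℝ => ((q.1, s), q.2)) (by fun_prop)
  rw [lintegral_lintegral_swap (hsurvival.mul (by fun_prop)).aemeasurable]
  refine lintegral_congr fun t => ?_
  dsimp only
  rw [lintegral_mul_const' _ _ ENNReal.ofReal_ne_top, lintegral_survival]

theorem sectionIntegral_jointDensity (hmean : meanReturnTime Γ g σ ≠ 0) (r : ℝ) :
    sectionIntegral σ (jointDensity Γ g σ r) =
      (meanReturnTime Γ g σ)⁻¹ * sectionIntegral σ (survival Γ g σ r) :=
  sectionIntegral_const_mul (ENNReal.inv_ne_top.2 hmean) (survival Γ g σ r)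

theorem ofReal_hittingDensity (hmean : meanReturnTime Γ g σ ≠ 0) (r : ℝ) :
    ENNReal.ofReal (hittingDensity Γ g σ r) =
      (meanReturnTime Γ g σ)⁻¹ * sectionIntegral σ (survival Γ g σ r) := by
  rw [hittingDensity, sectionIntegral_jointDensity hmean, ENNReal.ofReal_toReal]
  exact ENNReal.mul_ne_top (ENNReal.inv_ne_top.2 hmean)
    (ne_top_of_le_ne_top sectionIntegral_one_ne_top (sectionIntegral_mono (survival_le_one r)))

theorem extremeDensity_nonneg (s : ℝ) : 0 ≤ extremeDensity Γ g σ s :=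
  mul_nonneg (Real.exp_pos _).le ENNReal.toReal_nonneg

theorem measurable_extremeDensity [DiscreteTopology Γ] (hmean : meanReturnTime Γ g σ ≠ 0) :
    Measurable (extremeDensity Γ g σ) := by
  have h : Measurable (hittingDensity Γ g σ) := by
    unfold hittingDensity
    simp only [sectionIntegral_jointDensity hmean]
    exact (measurable_sectionIntegral_survival.const_mul _).ennreal_toReal
  unfold extremeDensity
  fun_prop

theorem lintegral_extremeDensity [DiscreteTopology Γ] (hmean : meanReturnTime Γ g σ ≠ 0)
    {S : Set ℝ} (hS : MeasurableSet S) {b : ℝ≥0∞}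
    (himg : (fun s => Real.exp (-1 * s)) '' S = {r : ℝ | 0 < r ∧ ENNReal.ofReal r < b}) :
    ∫⁻ s in S, ENNReal.ofReal (extremeDensity Γ g σ s) =
      (meanReturnTime Γ g σ)⁻¹ *
        sectionIntegral σ fun w => min b (backwardReturnTime Γ g σ w) := by
  calc ∫⁻ s in S, ENNReal.ofReal (extremeDensity Γ g σ s)
      = ∫⁻ s in S, ENNReal.ofReal (|-1| * Real.exp (-1 * s)) *
          ENNReal.ofReal (hittingDensity Γ g σ (Real.exp (-1 * s))) := by
        simp only [extremeDensity, ENNReal.ofReal_mul (Real.exp_pos _).le, abs_neg, abs_one,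
          one_mul, neg_one_mul]
    _ = ∫⁻ r in {r : ℝ | 0 < r ∧ ENNReal.ofReal r < b}, (meanReturnTime Γ g σ)⁻¹ *
          sectionIntegral σ (survival Γ g σ r) := by
        rw [← setLIntegral_exp_mul_substitution (neg_ne_zero.2 one_ne_zero) hS
          fun r => ENNReal.ofReal (hittingDensity Γ g σ r), himg]
        simp only [ofReal_hittingDensity hmean]
    _ = _ := by
        rw [lintegral_const_mul' _ _ (ENNReal.inv_ne_top.2 hmean),
          lintegral_sectionIntegral_survival]

theorem image_exp_neg_Ioi (H : ℝ) : (fun s => Real.exp (-1 * s)) '' Set.Ioi H =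
    {r : ℝ | 0 < r ∧ ENNReal.ofReal r < ENNReal.ofReal (Real.exp (-H))} := by
  ext r
  constructor
  · rintro ⟨s, hs, rfl⟩
    refine ⟨Real.exp_pos _, ?_⟩
    rw [ENNReal.ofReal_lt_ofReal_iff (Real.exp_pos _), Real.exp_lt_exp, neg_one_mul]
    exact neg_lt_neg hs
  · rintro ⟨h1, h2⟩
    rw [ENNReal.ofReal_lt_ofReal_iff (Real.exp_pos _), ← Real.log_lt_iff_lt_exp h1] at h2
    exact ⟨-Real.log r, lt_neg_of_lt_neg h2, by simp [Real.exp_log h1]⟩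

theorem lintegral_extremeDensity_eq_one [DiscreteTopology Γ] (hneg : (-1 : SL(2, ℝ)) ∈ Γ)
    (hF : IsFundamentalDomain Γ F Measure.haar) (hFfin : Measure.haar F ≠ ∞) (κ₀ : Fin K)
    (hg : IsCuspScaling Γ g) (σ : Fin K → ℝ) :
    ∫⁻ s, ENNReal.ofReal (extremeDensity Γ g σ s) = 1 := by
  have hmean := meanReturnTime_ne_zero hneg hF hFfin κ₀ hg σ
  have himg : (fun s => Real.exp (-1 * s)) '' Set.univ =
      {r : ℝ | 0 < r ∧ ENNReal.ofReal r < ∞} :=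
    (image_exp_mul_univ (neg_ne_zero.2 one_ne_zero)).trans (by ext; simp)
  rw [← setLIntegral_univ, lintegral_extremeDensity hmean MeasurableSet.univ himg]
  simp only [le_top, min_eq_right]
  rw [sectionIntegral_backwardReturnTime hneg hF hFfin κ₀ hg,
    ENNReal.inv_mul_cancel hmean (meanReturnTime_ne_top hneg hF hFfin κ₀ hg σ)]

theorem integrable_extremeDensity [DiscreteTopology Γ] (hneg : (-1 : SL(2, ℝ)) ∈ Γ)
    (hF : IsFundamentalDomain Γ F Measure.haar) (hFfin : Measure.haar F ≠ ∞) (κ₀ : Fin K)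
    (hg : IsCuspScaling Γ g) (σ : Fin K → ℝ) : Integrable (extremeDensity Γ g σ) := by
  refine ⟨(measurable_extremeDensity (meanReturnTime_ne_zero hneg hF hFfin κ₀ hg
    σ)).aestronglyMeasurable, ?_⟩
  rw [hasFiniteIntegral_iff_ofReal (ae_of_all _ extremeDensity_nonneg),
    lintegral_extremeDensity_eq_one hneg hF hFfin κ₀ hg]
  exact ENNReal.one_lt_top

theorem integral_extremeDensity_eq_one [DiscreteTopology Γ] (hneg : (-1 : SL(2, ℝ)) ∈ Γ)
    (hF : IsFundamentalDomain Γ F Measure.haar) (hFfin : Measure.haar F ≠ ∞) (κ₀ : Fin K)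
    (hg : IsCuspScaling Γ g) (σ : Fin K → ℝ) : ∫ s, extremeDensity Γ g σ s = 1 := by
  rw [integral_eq_lintegral_of_nonneg_ae (ae_of_all _ extremeDensity_nonneg)
    (integrable_extremeDensity hneg hF hFfin κ₀ hg σ).aestronglyMeasurable,
    lintegral_extremeDensity_eq_one hneg hF hFfin κ₀ hg, ENNReal.toReal_one]

theorem liouville_real_hitQuot_extremeRegion [DiscreteTopology Γ] (hneg : (-1 : SL(2, ℝ)) ∈ Γ)
    (hF : IsFundamentalDomain Γ F Measure.haar) (hFfin : Measure.haar F ≠ ∞) (κ₀ : Fin K)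
    (hg : IsCuspScaling Γ g) (σ : Fin K → ℝ) (H : ℝ) :
    (liouville Γ F).real (hitQuot Γ g (extremeRegion σ H)) =
      ∫ s in Set.Ioi H, extremeDensity Γ g σ s := by
  have hmean := meanReturnTime_ne_zero hneg hF hFfin κ₀ hg σ
  rw [integral_eq_lintegral_of_nonneg_ae (ae_of_all _ extremeDensity_nonneg)
      (measurable_extremeDensity hmean).aestronglyMeasurable,
    lintegral_extremeDensity hmean measurableSet_Ioi (image_exp_neg_Ioi H), measureReal_def,
    liouville_hitQuot_extremeRegion hneg hF hFfin κ₀ hg]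

end LimitDensity

end HorocycleExtremes

end

theorem mainTheorem2
    (Γ : Subgroup SL(2, ℝ)) [DiscreteTopology Γ] (hneg : (-1 : SL(2, ℝ)) ∈ Γ)
    (F : Set SL(2, ℝ)) (hF : IsFundamentalDomain Γ F Measure.haar)
    (hFfin : Measure.haar F ≠ ∞)
    (K : ℕ) (hK : 0 < K) (g : Fin K → SL(2, ℝ)) (hg : HorocycleExtremes.IsCuspScaling Γ g)
    (lam : Measure (HorocycleExtremes.UnitTangent Γ)) [IsProbabilityMeasure lam]
    (hlam : HorocycleExtremes.IsAdmissible (HorocycleExtremes.liouville Γ F) lam)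
    (σ : Fin K → ℝ) :
    (Integrable (HorocycleExtremes.extremeDensity Γ g σ) ∧
      (∀ s, 0 ≤ HorocycleExtremes.extremeDensity Γ g σ s) ∧
      ∫ s, HorocycleExtremes.extremeDensity Γ g σ s = 1) ∧
    ∀ H : ℝ,
      Tendsto (fun T : ℝ => lam.real {x₀ | ((H + Real.log T : ℝ) : EReal) <
          ⨆ s ∈ Set.Icc 0 T, HorocycleExtremes.relHeightSurface g σ
            (HorocycleExtremes.proj (HorocycleExtremes.unstableFlow s x₀))})
        atTop (𝓝 (∫ s in Set.Ioi H, HorocycleExtremes.extremeDensity Γ g σ s)) ∧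
      Tendsto (fun T : ℝ => lam.real {x₀ | ((H + Real.log T : ℝ) : EReal) <
          ⨆ ξ ∈ HorocycleExtremes.hittingTimes g σ 0 x₀ ∩ Set.Icc 0 T,
            HorocycleExtremes.relHeight g σ (HorocycleExtremes.unstableFlow ξ x₀)})
        atTop (𝓝 (∫ s in Set.Ioi H, HorocycleExtremes.extremeDensity Γ g σ s)) := by
  open HorocycleExtremes in
  have := isProbabilityMeasure_liouville hF hFfin
  let κ₀ : Fin K := ⟨0, hK⟩
  refine ⟨⟨integrable_extremeDensity hneg hF hFfin κ₀ hg σ, extremeDensity_nonneg,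
    integral_extremeDensity_eq_one hneg hF hFfin κ₀ hg σ⟩, fun H => ?_⟩
  rw [← liouville_real_hitQuot_extremeRegion hneg hF hFfin κ₀ hg σ H]
  exact ⟨tendsto_surfaceExtreme hneg hg hlam σ H, tendsto_sectionExtreme hg hlam σ H⟩
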